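/- Let $S$ be a compact connected oriented surface without boundary, with a pair of transverse measured singular foliations $F^s$ and $F^u$ having finitely many singularities, each of them an $n$-prong with $n\ge 1$. That is, each $p\in S$ has a number $n(p)\ge 1$ of prongs, with $n(p)\neq 2$ for finitely many $p$ only, and a complex coordinate $z_p$ centred at $p$, such that $n(x)=2$ for all $x\ne p$ in the domain of $z_p$, and near such an $x$ some branch of $z_p^{n(p)/2}$ equals $\pm z_x+c$ for a constant $c$. At points with $n(p)=2$ (the regular points) the leaves of $F^s$ and $F^u$ are the horizontal and the vertical lines of the coordinate $z_p$; in general, the leaf of $F^s$ (of $F^u$) near $p$ is the $n(p)$-prong $\{z_p^{n(p)}\ge 0\}$ (respectively $\{z_p^{n(p)}\le 0\}$), and a leaf consists of all points that can be reached from one of its points by paths inside the foliation. The corresponding flat metric has a cone point of angle $n(p)\pi$, hence of curvature $(2-n(p))\pi$, at $p$. Let $f\colon S\to S$ be a pseudo-Anosov map with these foliations: $f$ is a homeomorphism preserving the numbers of prongs and, for some $\lambda>1$, it has the form $(x,y)\mapsto(\pm\lambda^{-1}x,\pm\lambda y)$ in the coordinates $x+iy$ centred at $p$ and at $f(p)$,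 near each regular point $p$. Assume that the curvature is non-negative at every point, i.e. $n(p)\le 2$ for all $p$. Equip $S$ with any metric inducing its topology (for instance, the flat metric). Let $\mathcal C(S)$ be the set of non-empty compact connected subsets of $S$ with the Hausdorff metric $d_H$. For $A\in\mathcal C(S)$ let $i(A)=\{B\in\mathcal C(S): B\subset A\}$. For $\sigma\in\{s,u\}$ let $\mathcal C(F^\sigma)$ be the set of those $A\in\mathcal C(S)$ that are contained in a leaf of $F^\sigma$, and let $\tilde F^\sigma$ be the closure of $\mathcal C(F^\sigma)$ in $(\mathcal C(S),d_H)$. Denote by $d_{\tilde H}(A,\tilde F^\sigma)$ the Hausdorff distance, with respect to $d_H$, between the subsets $i(A)$ and $\tilde F^\sigma$ of $\mathcal C(S)$. Then, for $\sigma\in\{s,u\}$, the set $\tilde F^\sigma$ is a hypercontinuum (a non-empty compact connected subset of $\mathcal C(S)$) and $\tilde F^\sigma=\mathcal C(F^\sigma)\cup\{S\}$. Moreover, $$\lim_{n\to+\infty} d_{\tilde H}\bigl(f^{-n}(A^s),\tilde F^s\bigr)=0\quad\text{and}\quad \lim_{n\to+\infty} d_{\tilde H}\bigl(f^{n}(A^u),\tilde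 F^u\bigr)=0$$ for every $A^s\in\mathcal C(F^s)$ and every $A^u\in\mathcal C(F^u)$ with more than one point. -/

import Mathlib

open Set Filter Topology

noncomputable section

/-! ### Hyperspaces -/

/-- `Continuum X` is the hyperspace `C(X)` of (non-empty) compact connected subsets of `X`.
When `X` is a metric space, it carries the Hausdorff metric `dist_H`, inherited from
`TopologicalSpace.NonemptyCompacts X`. -/
abbrev Continuum (X : Type*) [TopologicalSpace X] : Type _ :=
  {A : TopologicalSpace.NonemptyCompacts X // IsConnected (A : Set X)}

namespace Continuum

/-- The underlying set of a continuum. -/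
def carrier {X : Type*} [TopologicalSpace X] (A : Continuum X) : Set X :=
  (A.1 : Set X)

/-- The whole space, as a continuum. -/
def whole (X : Type*) [TopologicalSpace X] [CompactSpace X] [ConnectedSpace X] : Continuum X :=
  ⟨⟨⟨univ, isCompact_univ⟩, univ_nonempty⟩, isConnected_univ⟩

/-- The image of a continuum under a homeomorphism. -/
def image {X : Type*} [TopologicalSpace X] (g : X ≃ₜ X) (A : Continuum X) : Continuum X :=
  ⟨⟨⟨g '' A.carrier, A.1.isCompact.image g.continuous⟩, A.1.nonempty.image g⟩,
    A.2.image g g.continuous.continuousOn⟩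

/-- The set `i(A) = C(A) ⊆ C(X)` of all subcontinua of the continuum `A`. -/
def subcontinua {X : Type*} [TopologicalSpace X] (A : Continuum X) : Set (Continuum X) :=
  {B | B.carrier ⊆ A.carrier}

/-- The second order Hausdorff distance between a continuum `A` of `X` and a set `H` of continua
of `X` (in practice a hypercontinuum): the Hausdorff distance, with respect to the Hausdorff
metric of `C(X)`, between `i(A)` and `H`. -/
def distTilde {X : Type*} [MetricSpace X] (A : Continuum X) (H : Set (Continuum X)) : ℝ :=
  Metric.hausdorffDist A.subcontinua H

end Continuum

/-! ### Pairs of transverse measured singular foliations, pseudo-Anosov maps -/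

/-- The two foliations of a pair: `stable` is the horizontal one, `unstable` the vertical one. -/
inductive FoliationKind : Type
  | stable
  | unstable

/-- The real numbers `≥ 0` (stable case) or `≤ 0` (unstable case), inside `ℂ`. For `n ≥ 1` the
set of all `z` with `z ^ n` in `σ.halfLine` is a star made of `n` rays issuing from `0`; for
`n = 2` it is the horizontal, respectively the vertical, line through `0`. -/
def FoliationKind.halfLine : FoliationKind → Set ℂ
  | .stable => {z | z.im = 0 ∧ 0 ≤ z.re}
  | .unstable => {z | z.im = 0 ∧ z.re ≤ 0}

/-- A pair of transverse measured singular foliations on an oriented surface `S` without boundary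
(equivalently, a flat structure with cone points and with a parallel pair of orthogonal line
fields), given by its natural coordinates.

Each point `p` is an `n`-prong with `n = prongs p ≥ 1` (`n = 2` means that `p` is regular) and is
the centre of a coordinate `z = chart p`. In the coordinate `z`, the flat structure with the
two foliations is the pull-back, away from `p`, of the standard one of `ℂ` (horizontal and vertical
lines, with transverse measures `|d Im w|` and `|d Re w|`) under the two-valued function
`w = ± z ^ (n / 2)`; so `p` is a cone point of angle `n π`. That is what `compat` says:
every point `x ≠ p` of the domain of `chart p` is regular, and near `x` a branch of
`z ^ (n / 2)` differs from the regular coordinate `chart x` by a translation (and possibly a sign,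
which disappears on squaring). In particular changes of regular coordinates
have the form `w ↦ ± w + c`. -/
structure FoliationPair (S : Type*) [TopologicalSpace S] where
  /-- the number of prongs at a point -/
  prongs : S → ℕ
  one_le_prongs : ∀ p, 1 ≤ prongs p
  /-- the natural coordinate centred at a point -/
  chart : S → OpenPartialHomeomorph S ℂ
  mem_source : ∀ p, p ∈ (chart p).source
  chart_self : ∀ p, chart p p = 0
  compat : ∀ p, ∀ x ∈ (chart p).source, x ≠ p →
    prongs x = 2 ∧ ∃ c : ℂ, ∀ᶠ y in 𝓝 x, (chart x y + c) ^ 2 = (chart p y) ^ (prongs p)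
  finite_singularities : {p | prongs p ≠ 2}.Finite

namespace FoliationPair

variable {S : Type*} [TopologicalSpace S]

/-- The curvature of the flat metric concentrated at `p`: `2 π` minus the cone angle `n π`. -/
def curvature (F : FoliationPair S) (p : S) : ℝ :=
  (2 - (F.prongs p : ℝ)) * Real.pi

/-- The leaf through `x` of one of the foliations: the set of end points `y` of the paths from `x`
that run inside the foliation, i.e. that stay, near each time `t`, in the star of
`n` rays (a horizontal or vertical line, if `n = 2`) issuing from the point `γ t` in the
natural coordinate at this point. -/
def leaf (F : FoliationPair S) (σ : FoliationKind) (x : S) : Set S :=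
  {y | ∃ γ : Path x y, ∀ t : unitInterval, ∀ᶠ s in 𝓝 t,
    (F.chart (γ t) (γ s)) ^ (F.prongs (γ t)) ∈ σ.halfLine}

/-- `C(F^σ)`: the continua contained in a leaf of the foliation `F^σ`. -/
def leafContinua (F : FoliationPair S) (σ : FoliationKind) : Set (Continuum S) :=
  {A | ∃ x, A.carrier ⊆ F.leaf σ x}

/-- `f` is pseudo-Anosov with stable and unstable foliations given by the pair `F`: for some
`lam > 1` it preserves the singular foliations, contracting the stable leaves by the factor `lam`
and expanding the unstable leaves by the factor `lam`. -/
def IsPseudoAnosov (F : FoliationPair S) (f : S ≃ₜ S) : Prop :=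
  ∃ lam : ℝ, 1 < lam ∧ (∀ p, F.prongs (f p) = F.prongs p) ∧
    ∀ p, F.prongs p = 2 →
      ∃ ε δ : ℝ, (ε = 1 ∨ ε = -1) ∧ (δ = 1 ∨ δ = -1) ∧ ∀ᶠ x in 𝓝 p,
        (F.chart (f p) (f x)).re = ε * lam⁻¹ * (F.chart p x).re ∧
        (F.chart (f p) (f x)).im = δ * lam * (F.chart p x).im

end FoliationPair

/-- The hypercontinuum associated to a foliation: the closure of `C(F^σ)` in `C(S)` with respect to
the Hausdorff metric. -/
def FoliationPair.hyper {S : Type*} [MetricSpace S] (F : FoliationPair S) (σ : FoliationKind) :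
    Set (Continuum S) :=
  closure (F.leafContinua σ)

end

/-!
Since the curvature is non-negative, all points are regular or 1-prongs, and a 1-prong is the
quotient of the flat plane by `z ↦ -z`. So `S` is a flat orbifold whose changes of coordinates are
`z ↦ ± z + c`. Being compact it is complete, and there is a developing map `E : ℂ → S`, equal near
every point to a natural coordinate unfolded by a square root
(`FoliationPair.IsDevelopingAt.exists_global`): local developing maps exist on balls of a uniform
radius, and they glue along growing balls by unique continuation. Unique continuation also shows
that two global developing maps with a common value differ by some `z ↦ ± z + c`; hence the fibres of
`E` are the orbits of a discrete cocompact group (`IsFlatCover`), the leaves are the images of the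
horizontal and of the vertical lines (`FoliationPair.leaf_eq_range`), and the pseudo-Anosov map lifts
to an affine map with linear part `diag(± λ⁻¹, ± λ)` (`FoliationPair.IsPseudoAnosov.exists_lift`).

The rest takes place in the plane, rotated so that the leaves in question are horizontal. The
heights of the periods of `E` form a subgroup of `ℝ` invariant under a contraction, and no period is
horizontal, so this subgroup is dense; with compactness, long horizontal arcs are
uniformly almost dense in `S` (`IsFlatCover.exists_length_arc_near`). A continuum in a leaf is an arc
(`IsFlatCover.exists_eq_arc`): the leaf meets verticals in countable sets only, so the continuum can
be enclosed in thin rectangles with boundary off the continuum. Arcs of bounded length form a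
compact set, and arcs with lengths tending to infinity converge to `S`; this determines the
closure of the set of arcs. Finally, the iterates of an arc get long, and a long arc contains
approximations, modulo periods, of all arcs of bounded length.
-/

noncomputable section

namespace FoliationPair

variable {S : Type*} [TopologicalSpace S]

/-! ### Orbifold charts and developing maps -/

/-- The inverse of the natural coordinate at `p`, unfolded at a 1-prong: `h ↦ z_p⁻¹(h)` at a
regular point and `h ↦ z_p⁻¹(h ^ 2)` at a 1-prong (`2 / n` is `1`, respectively `2`). Only the
values at small `h` matter. -/
def orbifoldChart (F : FoliationPair S) (p : S) (h : ℂ) : S :=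
  (F.chart p).symm (h ^ (2 / F.prongs p))

/-- `E` is, near `w`, a local isometry of the flat plane onto the flat orbifold `S` that
respects the horizontal and vertical directions: it is the orbifold chart at `E w`, up to the
translation by `w` and a sign. -/
def IsDevelopingAt (F : FoliationPair S) (E : ℂ → S) (w : ℂ) : Prop :=
  ∃ ε : ℂ, (ε = 1 ∨ ε = -1) ∧ ∀ᶠ z in 𝓝 w, E z = F.orbifoldChart (E w) (ε * (z - w))

/-- All points of the foliated surface are regular or 1-prongs. -/
def ProngsLeTwo (F : FoliationPair S) : Prop := ∀ p, F.prongs p = 1 ∨ F.prongs p = 2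

lemma prongsLeTwo_of_curvature {F : FoliationPair S} (h : ∀ p, 0 ≤ F.curvature p) :
    F.ProngsLeTwo := by
  intro p
  have h1 := F.one_le_prongs p
  have h2 : (F.prongs p : ℝ) ≤ 2 := by
    have := nonneg_of_mul_nonneg_left (h p) Real.pi_pos
    linarith
  have h3 : F.prongs p ≤ 2 := by exact_mod_cast h2
  omega

variable {F : FoliationPair S}

lemma two_div_prongs_ne_zero (hF : F.ProngsLeTwo) (p : S) : 2 / F.prongs p ≠ 0 := by
  rcases hF p with h | h <;> simp [h]

lemma two_div_prongs_mul (hF : F.ProngsLeTwo) (p : S) : 2 / F.prongs p * F.prongs p = 2 := by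
  rcases hF p with h | h <;> simp [h]

lemma orbifoldChart_zero (hF : F.ProngsLeTwo) (p : S) : F.orbifoldChart p 0 = p := by
  have := (F.chart p).left_inv (F.mem_source p)
  rw [F.chart_self] at this
  rw [orbifoldChart, zero_pow (two_div_prongs_ne_zero hF p), this]

lemma zero_mem_target (F : FoliationPair S) (p : S) : (0 : ℂ) ∈ (F.chart p).target := by
  have := (F.chart p).map_source (F.mem_source p)
  rwa [F.chart_self] at this

lemma eventually_pow_mem_target (F : FoliationPair S) (p : S) {h : ℂ}
    (hh : h ^ (2 / F.prongs p) ∈ (F.chart p).target) :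
    ∀ᶠ z in 𝓝 h, z ^ (2 / F.prongs p) ∈ (F.chart p).target :=
  ((continuous_pow (2 / F.prongs p)).continuousAt (x := h)).eventually
    ((F.chart p).open_target.mem_nhds hh)

lemma eventually_zero_pow_mem_target (hF : F.ProngsLeTwo) (p : S) :
    ∀ᶠ z in 𝓝 (0 : ℂ), z ^ (2 / F.prongs p) ∈ (F.chart p).target := by
  apply F.eventually_pow_mem_target
  rw [zero_pow (two_div_prongs_ne_zero hF p)]
  exact F.zero_mem_target p

lemma continuousAt_orbifoldChart (F : FoliationPair S) (p : S) {h : ℂ}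
    (hh : h ^ (2 / F.prongs p) ∈ (F.chart p).target) :
    ContinuousAt (F.orbifoldChart p) h :=
  ContinuousAt.comp (f := fun z : ℂ => z ^ (2 / F.prongs p)) ((F.chart p).continuousAt_symm hh)
    (continuous_pow _).continuousAt

lemma continuousAt_orbifoldChart_zero (hF : F.ProngsLeTwo) (p : S) :
    ContinuousAt (F.orbifoldChart p) 0 :=
  F.continuousAt_orbifoldChart p (eventually_zero_pow_mem_target hF p).self_of_nhds

lemma chart_orbifoldChart (F : FoliationPair S) (p : S) {h : ℂ}
    (hh : h ^ (2 / F.prongs p) ∈ (F.chart p).target) :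
    F.chart p (F.orbifoldChart p h) = h ^ (2 / F.prongs p) :=
  (F.chart p).right_inv hh

lemma chart_orbifoldChart_pow (hF : F.ProngsLeTwo) (p : S) {h : ℂ}
    (hh : h ^ (2 / F.prongs p) ∈ (F.chart p).target) :
    F.chart p (F.orbifoldChart p h) ^ F.prongs p = h ^ 2 := by
  rw [F.chart_orbifoldChart p hh, ← pow_mul, two_div_prongs_mul hF]

/-- The orbifold chart at `p` maps neighbourhoods of `0` onto neighbourhoods of `p`. -/
lemma eventually_exists_orbifoldChart_eq (hF : F.ProngsLeTwo) (p : S) {s : Set ℂ}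
    (hs : s ∈ 𝓝 (0 : ℂ)) : ∀ᶠ y in 𝓝 p, ∃ h ∈ s, F.orbifoldChart p h = y := by
  obtain ⟨r, hr, hrs⟩ := Metric.mem_nhds_iff.1 hs
  have h1 : ∀ᶠ y in 𝓝 p, y ∈ (F.chart p).source :=
    (F.chart p).open_source.mem_nhds (F.mem_source p)
  have h2 : ∀ᶠ y in 𝓝 p, F.chart p y ∈ Metric.ball (0 : ℂ) (r ^ (2 / F.prongs p)) := by
    apply ((F.chart p).continuousAt (F.mem_source p)).eventually
    rw [F.chart_self]
    exact Metric.ball_mem_nhds _ (by positivity)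
  filter_upwards [h1, h2] with y hy1 hy2
  obtain ⟨h, hh⟩ := IsAlgClosed.exists_pow_nat_eq (F.chart p y)
    (Nat.pos_of_ne_zero (two_div_prongs_ne_zero hF p))
  refine ⟨h, hrs ?_, ?_⟩
  · rw [← hh, mem_ball_zero_iff, norm_pow] at hy2
    rw [mem_ball_zero_iff]
    exact lt_of_pow_lt_pow_left₀ _ hr.le hy2
  · rw [orbifoldChart, hh, (F.chart p).left_inv hy1]

lemma IsDevelopingAt.continuousAt (hF : F.ProngsLeTwo) {E : ℂ → S} {w : ℂ}
    (h : F.IsDevelopingAt E w) : ContinuousAt E w := by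
  obtain ⟨ε, -, h⟩ := h
  have h1 : ContinuousAt (fun z => F.orbifoldChart (E w) (ε * (z - w))) w := by
    apply ContinuousAt.comp (g := F.orbifoldChart (E w))
    · simpa using continuousAt_orbifoldChart_zero hF (E w)
    · fun_prop
  exact h1.congr_of_eventuallyEq h

lemma IsDevelopingAt.congr {E E' : ℂ → S} {w : ℂ} (h : F.IsDevelopingAt E w)
    (hE : E =ᶠ[𝓝 w] E') : F.IsDevelopingAt E' w := by
  obtain ⟨ε, hε, h⟩ := h
  refine ⟨ε, hε, ?_⟩
  rw [← hE.self_of_nhds]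
  filter_upwards [h, hE] with z h1 h2
  rw [← h2, h1]

lemma IsDevelopingAt.comp_affine {E : ℂ → S} {ε c w : ℂ} (hε : ε = 1 ∨ ε = -1)
    (h : F.IsDevelopingAt E (ε * w + c)) : F.IsDevelopingAt (fun z => E (ε * z + c)) w := by
  obtain ⟨δ, hδ, h⟩ := h
  refine ⟨δ * ε, ?_, ?_⟩
  · rcases hε with rfl | rfl <;> rcases hδ with rfl | rfl <;> simp
  · have h1 : Tendsto (fun z : ℂ => ε * z + c) (𝓝 w) (𝓝 (ε * w + c)) :=
      (by fun_prop : Continuous fun z : ℂ => ε * z + c).tendsto w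
    filter_upwards [h1.eventually h] with z hz
    rw [hz]
    congr 1
    ring

/-- The orbifold chart at `p` is itself a developing map near `0`: this is the compatibility of
the natural coordinates. -/
lemma eventually_isDevelopingAt_orbifoldChart (hF : F.ProngsLeTwo) (p : S) :
    ∀ᶠ h in 𝓝 (0 : ℂ), F.IsDevelopingAt (F.orbifoldChart p) h := by
  filter_upwards [eventually_zero_pow_mem_target hF p] with h hh
  rcases eq_or_ne h 0 with rfl | h0
  · refine ⟨1, Or.inl rfl, Eventually.of_forall fun z => ?_⟩
    rw [orbifoldChart_zero hF, one_mul, sub_zero]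
  set x := F.orbifoldChart p h with hx
  have hxs : x ∈ (F.chart p).source := (F.chart p).map_target hh
  have hxp : x ≠ p := by
    intro hxp
    have h1 := F.chart_orbifoldChart p hh
    rw [← hx, hxp, F.chart_self] at h1
    exact pow_ne_zero _ h0 h1.symm
  obtain ⟨hx2, c, hc⟩ := F.compat p x hxs hxp
  have hc0 : c ^ 2 = h ^ 2 := by
    have := hc.self_of_nhds
    rwa [F.chart_self, zero_add, hx, chart_orbifoldChart_pow hF p hh] at this
  have hcont := F.continuousAt_orbifoldChart p hh
  obtain ⟨s, hs, rfl⟩ : ∃ s : ℂ, (s = 1 ∨ s = -1) ∧ c = s * h := by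
    rcases sq_eq_sq_iff_eq_or_eq_neg.1 hc0 with h1 | h1
    · exact ⟨1, Or.inl rfl, by simp [h1]⟩
    · exact ⟨-1, Or.inr rfl, by simp [h1]⟩
  have hs2 : s * s = 1 := by rcases hs with rfl | rfl <;> norm_num
  have hcont2 : ContinuousAt (fun z => F.chart x (F.orbifoldChart p z) + s * h + s * z) h := by
    have h1 : ContinuousAt (fun z => F.chart x (F.orbifoldChart p z)) h :=
      ContinuousAt.comp ((F.chart x).continuousAt (F.mem_source x)) hcont
    fun_prop
  have hne : ∀ᶠ z in 𝓝 h, F.chart x (F.orbifoldChart p z) + s * h + s * z ≠ 0 := by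
    apply hcont2.eventually_ne
    rw [← hx, F.chart_self, zero_add, ← two_mul]
    have : s ≠ 0 := by rintro rfl; simp at hs2
    exact mul_ne_zero two_ne_zero (mul_ne_zero this h0)
  refine ⟨s, hs, ?_⟩
  filter_upwards [hne, hcont.eventually hc, F.eventually_pow_mem_target p hh,
    hcont.eventually ((F.chart x).open_source.mem_nhds (F.mem_source x))] with z h1 h2 h3 h4
  rw [chart_orbifoldChart_pow hF p h3] at h2
  have h5 : F.chart x (F.orbifoldChart p z) = s * (z - h) := by
    have h6 : (F.chart x (F.orbifoldChart p z) + s * h - s * z) *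
        (F.chart x (F.orbifoldChart p z) + s * h + s * z) = 0 := by
      linear_combination h2 - z ^ 2 * hs2
    have h7 := (mul_eq_zero.1 h6).resolve_right h1
    linear_combination h7
  have h6 := (F.chart x).left_inv h4
  rw [h5] at h6
  change F.orbifoldChart p z = (F.chart x).symm ((s * (z - h)) ^ (2 / F.prongs x))
  rw [hx2, Nat.div_self two_pos, pow_one, h6]

/-- At a 1-prong the orbifold chart is even, and at a regular point it is injective: so one
non-zero argument detects the sign. -/
lemma orbifoldChart_sign (hF : F.ProngsLeTwo) (p : S) {ε₁ ε₂ h : ℂ} (h₁ : ε₁ = 1 ∨ ε₁ = -1)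
    (h₂ : ε₂ = 1 ∨ ε₂ = -1) (h0 : h ≠ 0)
    (ht₁ : (ε₁ * h) ^ (2 / F.prongs p) ∈ (F.chart p).target)
    (ht₂ : (ε₂ * h) ^ (2 / F.prongs p) ∈ (F.chart p).target)
    (heq : F.orbifoldChart p (ε₁ * h) = F.orbifoldChart p (ε₂ * h)) (z : ℂ) :
    F.orbifoldChart p (ε₁ * z) = F.orbifoldChart p (ε₂ * z) := by
  rcases hF p with hp | hp
  · have : (ε₁ * z) ^ 2 = (ε₂ * z) ^ 2 := by
      rcases h₁ with rfl | rfl <;> rcases h₂ with rfl | rfl <;> ring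
    simp [orbifoldChart, hp, this]
  · have h3 := F.chart_orbifoldChart p ht₁
    rw [heq, F.chart_orbifoldChart p ht₂, hp, Nat.div_self two_pos, pow_one, pow_one] at h3
    rw [mul_right_cancel₀ h0 h3]

lemma tendsto_sign_mul_sub (ε w : ℂ) : Tendsto (fun z : ℂ => ε * (z - w)) (𝓝 w) (𝓝 0) := by
  have : Continuous fun z : ℂ => ε * (z - w) := by fun_prop
  simpa using this.tendsto w

/-- Two developing maps that agree at points accumulating at `w` agree near `w`. -/
lemma IsDevelopingAt.eventuallyEq [T2Space S] (hF : F.ProngsLeTwo) {E₁ E₂ : ℂ → S} {w : ℂ}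
    (h₁ : F.IsDevelopingAt E₁ w) (h₂ : F.IsDevelopingAt E₂ w)
    (h : ∃ᶠ z in 𝓝[≠] w, E₁ z = E₂ z) : E₁ =ᶠ[𝓝 w] E₂ := by
  have hw : E₁ w = E₂ w :=
    tendsto_nhds_unique_of_frequently_eq ((h₁.continuousAt hF).tendsto.mono_left nhdsWithin_le_nhds)
      ((h₂.continuousAt hF).tendsto.mono_left nhdsWithin_le_nhds) h
  obtain ⟨ε₁, hε₁, h₁⟩ := h₁
  obtain ⟨ε₂, hε₂, h₂⟩ := h₂
  rw [← hw] at h₂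
  have ht := eventually_zero_pow_mem_target hF (E₁ w)
  have ht₁ := (tendsto_sign_mul_sub ε₁ w).eventually ht
  have ht₂ := (tendsto_sign_mul_sub ε₂ w).eventually ht
  obtain ⟨z, hz, hzw, e₁, e₂, t₁, t₂⟩ := (h.and_eventually
    (eventually_mem_nhdsWithin.and (((h₁.and (h₂.and (ht₁.and ht₂)))).filter_mono
      nhdsWithin_le_nhds))).exists
  have hz0 : z - w ≠ 0 := sub_ne_zero.2 hzw
  rw [e₁, e₂] at hz
  filter_upwards [h₁, h₂] with y y₁ y₂
  rw [y₁, y₂]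
  exact orbifoldChart_sign hF _ hε₁ hε₂ hz0 t₁ t₂ hz _

/-- Unique continuation of developing maps. -/
lemma eqOn_of_isDevelopingAt [T2Space S] (hF : F.ProngsLeTwo) {E₁ E₂ : ℂ → S} {U : Set ℂ}
    (hU : IsPreconnected U) (h₁ : ∀ w ∈ U, F.IsDevelopingAt E₁ w)
    (h₂ : ∀ w ∈ U, F.IsDevelopingAt E₂ w) {w₀ : ℂ} (hw₀ : w₀ ∈ U) (h : E₁ =ᶠ[𝓝 w₀] E₂) :
    ∀ w ∈ U, E₁ =ᶠ[𝓝 w] E₂ := by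
  have hV : IsOpen {w | E₁ =ᶠ[𝓝 w] E₂} := by
    rw [isOpen_iff_mem_nhds]
    intro w hw
    exact hw.eventually_nhds
  apply hU.subset_of_closure_inter_subset hV ⟨w₀, hw₀, h⟩
  rintro w ⟨hw, hwU⟩
  by_cases hwV : E₁ =ᶠ[𝓝 w] E₂
  · exact hwV
  refine (h₁ w hwU).eventuallyEq hF (h₂ w hwU) ?_
  rw [mem_closure_iff_frequently] at hw
  rw [frequently_nhdsWithin_iff]
  refine hw.mono fun z hz => ⟨hz.self_of_nhds, ?_⟩
  rintro rfl
  exact hwV hz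

/-- Two germs of developing maps with the same value differ by a sign. -/
lemma IsDevelopingAt.eventuallyEq_affine {E₁ E₂ : ℂ → S} {w₁ w₂ : ℂ}
    (h₁ : F.IsDevelopingAt E₁ w₁) (h₂ : F.IsDevelopingAt E₂ w₂) (h : E₁ w₁ = E₂ w₂) :
    ∃ ε : ℂ, (ε = 1 ∨ ε = -1) ∧ E₁ =ᶠ[𝓝 w₁] fun z => E₂ (ε * z + (w₂ - ε * w₁)) := by
  obtain ⟨ε₁, hε₁, h₁⟩ := h₁
  obtain ⟨ε₂, hε₂, h₂⟩ := h₂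
  refine ⟨ε₂ * ε₁, ?_, ?_⟩
  · rcases hε₁ with rfl | rfl <;> rcases hε₂ with rfl | rfl <;> simp
  have h3 : Tendsto (fun z : ℂ => ε₂ * ε₁ * z + (w₂ - ε₂ * ε₁ * w₁)) (𝓝 w₁) (𝓝 w₂) := by
    have : Continuous (fun z : ℂ => ε₂ * ε₁ * z + (w₂ - ε₂ * ε₁ * w₁)) := by fun_prop
    simpa using this.tendsto w₁
  filter_upwards [h₁, h3.eventually h₂] with z e₁ e₂
  rw [e₁, e₂, h]
  congr 1
  rcases hε₂ with rfl | rfl <;> ring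

/-! ### Global developing maps -/

/-- By compactness, developing maps exist on balls of a uniform radius around any point. -/
lemma exists_uniform_radius [CompactSpace S] (hF : F.ProngsLeTwo) :
    ∃ r > 0, ∀ x : S, ∃ ψ : ℂ → S, ψ 0 = x ∧ ∀ z ∈ Metric.ball (0 : ℂ) r, F.IsDevelopingAt ψ z := by
  have h1 : ∀ p : S, ∃ r > 0, ∀ z ∈ Metric.ball (0 : ℂ) r,
      F.IsDevelopingAt (F.orbifoldChart p) z := fun p =>
    Metric.eventually_nhds_iff_ball.1 (eventually_isDevelopingAt_orbifoldChart hF p)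
  choose r hr hd using h1
  have h2 : ∀ p : S, {y | ∃ h ∈ Metric.ball (0 : ℂ) (r p / 2), F.orbifoldChart p h = y} ∈ 𝓝 p :=
    fun p => eventually_exists_orbifoldChart_eq hF p (Metric.ball_mem_nhds _ (half_pos (hr p)))
  obtain ⟨t, -, ht⟩ := isCompact_univ.elim_nhds_subcover _ fun p (_ : p ∈ univ) => h2 p
  obtain ⟨ρ, hρ, hρt⟩ : ∃ ρ > 0, ∀ p ∈ t, ρ ≤ r p / 2 := by
    clear ht
    classical
    induction t using Finset.induction_on with
    | empty => exact ⟨1, one_pos, by simp⟩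
    | insert a t _ ih =>
      obtain ⟨ρ, hρ, h⟩ := ih
      refine ⟨min ρ (r a / 2), lt_min hρ (half_pos (hr a)), fun p hp => ?_⟩
      rcases Finset.mem_insert.1 hp with rfl | hp
      · exact min_le_right _ _
      · exact (min_le_left _ _).trans (h p hp)
  refine ⟨ρ, hρ, fun x => ?_⟩
  obtain ⟨p, hp, h, hh, hx⟩ := mem_iUnion₂.1 (ht (mem_univ x))
  refine ⟨fun z => F.orbifoldChart p (1 * z + h), by simp [hx], fun z hz => ?_⟩
  apply IsDevelopingAt.comp_affine (E := F.orbifoldChart p) (Or.inl rfl)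
  apply hd p
  rw [mem_ball_zero_iff] at *
  calc ‖1 * z + h‖ ≤ ‖z‖ + ‖h‖ := by rw [one_mul]; exact norm_add_le _ _
    _ < r p / 2 + r p / 2 := add_lt_add (hz.trans_le (hρt p hp)) hh
    _ = r p := by ring

/-- A germ of a developing map extends to a ball of the uniform radius. -/
lemma IsDevelopingAt.exists_extension_ball {r : ℝ}
    (hr : ∀ x : S, ∃ ψ : ℂ → S, ψ 0 = x ∧ ∀ z ∈ Metric.ball (0 : ℂ) r, F.IsDevelopingAt ψ z)
    (hr0 : 0 < r) {E : ℂ → S} {w : ℂ} (h : F.IsDevelopingAt E w) :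
    ∃ ψ : ℂ → S, ψ =ᶠ[𝓝 w] E ∧ ∀ z ∈ Metric.ball w r, F.IsDevelopingAt ψ z := by
  obtain ⟨ψ, hψ, hd⟩ := hr (E w)
  obtain ⟨ε, hε, he⟩ := h.eventuallyEq_affine (hd 0 (Metric.mem_ball_self hr0)) hψ.symm
  refine ⟨_, he.symm, fun z hz => ?_⟩
  apply IsDevelopingAt.comp_affine hε
  apply hd
  have h1 : ε * z + (0 - ε * w) = ε * (z - w) := by ring
  have h2 : ‖ε‖ = 1 := by rcases hε with rfl | rfl <;> simp
  rw [mem_ball_iff_norm] at hz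
  rw [mem_ball_zero_iff, h1, norm_mul, h2, one_mul]
  exact hz

/-- A developing map on a convex open set `U` extends to the `r`-neighbourhood of `U`: two balls of
radius `r` centred in `U` that meet contain the midpoint of their centres, which lies in `U`,
so the local extensions agree on the overlap. -/
lemma exists_extension_thickening [T2Space S] (hF : F.ProngsLeTwo) {r : ℝ}
    (hr : ∀ x : S, ∃ ψ : ℂ → S, ψ 0 = x ∧ ∀ z ∈ Metric.ball (0 : ℂ) r, F.IsDevelopingAt ψ z)
    (hr0 : 0 < r) {U : Set ℂ} (hUc : Convex ℝ U) {E : ℂ → S}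
    (hE : ∀ w ∈ U, F.IsDevelopingAt E w) :
    ∃ E' : ℂ → S, (∀ w ∈ U, E' =ᶠ[𝓝 w] E) ∧
      ∀ w ∈ Metric.thickening r U, F.IsDevelopingAt E' w := by
  have h1 : ∀ w : U, ∃ ψ : ℂ → S, ψ =ᶠ[𝓝 (w : ℂ)] E ∧
      ∀ z ∈ Metric.ball (w : ℂ) r, F.IsDevelopingAt ψ z :=
    fun w => (hE w w.2).exists_extension_ball hr hr0
  choose ψ hψE hψ using h1
  have hmid : ∀ w w' : U, ∀ z ∈ Metric.ball (w : ℂ) r ∩ Metric.ball (w' : ℂ) r,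
      ψ w =ᶠ[𝓝 z] ψ w' := by
    intro w w' z hz
    have hzw := hz.1
    have hzw' := hz.2
    rw [Metric.mem_ball] at hzw hzw'
    have hww' : dist (w : ℂ) w' < 2 * r := by
      have := dist_triangle_left (w : ℂ) w' z
      linarith
    set m : ℂ := midpoint ℝ (w : ℂ) w' with hm
    have hmU : m ∈ U := hUc.midpoint_mem w.2 w'.2
    have hmw : m ∈ Metric.ball (w : ℂ) r := by
      rw [Metric.mem_ball, hm, dist_midpoint_left]
      norm_num
      linarith
    have hmw' : m ∈ Metric.ball (w' : ℂ) r := by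
      rw [Metric.mem_ball, hm, dist_midpoint_right]
      norm_num
      linarith
    have hagree : ∀ v : U, m ∈ Metric.ball (v : ℂ) r → ψ v =ᶠ[𝓝 m] E := by
      intro v hmv
      refine eqOn_of_isDevelopingAt hF (hUc.inter (convex_ball (v : ℂ) r)).isPreconnected
        (fun y hy => hψ v y hy.2) (fun y hy => hE y hy.1) ⟨v.2, Metric.mem_ball_self hr0⟩
        (hψE v) m ⟨hmU, hmv⟩
    exact eqOn_of_isDevelopingAt hF
      ((convex_ball (w : ℂ) r).inter (convex_ball (w' : ℂ) r)).isPreconnected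
      (fun y hy => hψ w y hy.1) (fun y hy => hψ w' y hy.2) ⟨hmw, hmw'⟩
      ((hagree w hmw).trans (hagree w' hmw').symm) z hz
  classical
  let E' : ℂ → S := fun z =>
    if h : ∃ w : U, z ∈ Metric.ball (w : ℂ) r then ψ h.choose z else E z
  have hE' : ∀ w : U, ∀ z ∈ Metric.ball (w : ℂ) r, E' =ᶠ[𝓝 z] ψ w := by
    intro w z hz
    filter_upwards [Metric.isOpen_ball.mem_nhds hz] with y hy
    have h : ∃ w : U, y ∈ Metric.ball (w : ℂ) r := ⟨w, hy⟩
    simp only [E', dif_pos h]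
    exact (hmid _ _ y ⟨h.choose_spec, hy⟩).self_of_nhds
  refine ⟨E', fun w hw => ?_, fun w hw => ?_⟩
  · exact (hE' ⟨w, hw⟩ w (Metric.mem_ball_self hr0)).trans (hψE ⟨w, hw⟩)
  · obtain ⟨u, hu, huw⟩ := Metric.mem_thickening_iff.1 hw
    exact (hψ ⟨u, hu⟩ w huw).congr (hE' ⟨u, hu⟩ w huw).symm

/-- Completeness of the compact flat orbifold: every germ of a developing map extends to the
whole plane. -/
lemma IsDevelopingAt.exists_global [T2Space S] [CompactSpace S] (hF : F.ProngsLeTwo) {E : ℂ → S}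
    {w₀ : ℂ}
    (h : F.IsDevelopingAt E w₀) :
    ∃ E' : ℂ → S, E' =ᶠ[𝓝 w₀] E ∧ ∀ w, F.IsDevelopingAt E' w := by
  obtain ⟨r, hr0, hr⟩ := exists_uniform_radius hF
  have key : ∀ n : ℕ, ∃ E' : ℂ → S, E' =ᶠ[𝓝 w₀] E ∧
      ∀ w ∈ Metric.ball w₀ (r * (n + 1)), F.IsDevelopingAt E' w := by
    intro n
    induction n with
    | zero => simpa using h.exists_extension_ball hr hr0
    | succ n ih =>
      obtain ⟨E₁, hE₁, hd⟩ := ih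
      have hpos : 0 < r * ((n : ℝ) + 1) := by positivity
      obtain ⟨E₂, hE₂, hd₂⟩ := exists_extension_thickening hF hr hr0
        (convex_ball w₀ (r * ((n : ℝ) + 1))) hd
      refine ⟨E₂, (hE₂ w₀ (Metric.mem_ball_self hpos)).trans hE₁, fun w hw => hd₂ w ?_⟩
      have hrn : r + r * ((n : ℝ) + 1) = r * (((n + 1 : ℕ) : ℝ) + 1) := by
        push_cast
        ring
      rw [thickening_ball hr0 hpos, hrn]
      exact hw
  choose G hG hd using key
  have hex : ∀ z : ℂ, ∃ n : ℕ, z ∈ Metric.ball w₀ (r * (n + 1)) := by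
    intro z
    obtain ⟨n, hn⟩ := exists_nat_gt (dist z w₀ / r)
    refine ⟨n, ?_⟩
    rw [Metric.mem_ball]
    rw [div_lt_iff₀ hr0] at hn
    nlinarith
  choose N hN using hex
  have hpos : ∀ n : ℕ, 0 < r * ((n : ℝ) + 1) := fun n => by positivity
  have hagree : ∀ n m : ℕ, ∀ z ∈ Metric.ball w₀ (r * ((n : ℝ) + 1)) ∩
      Metric.ball w₀ (r * ((m : ℝ) + 1)), G n z = G m z := by
    intro n m z hz
    exact (eqOn_of_isDevelopingAt hF ((convex_ball _ _).inter (convex_ball _ _)).isPreconnected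
      (fun y hy => hd n y hy.1) (fun y hy => hd m y hy.2)
      ⟨Metric.mem_ball_self (hpos n), Metric.mem_ball_self (hpos m)⟩
      ((hG n).trans (hG m).symm) z hz).self_of_nhds
  have hloc : ∀ n : ℕ, ∀ z ∈ Metric.ball w₀ (r * ((n : ℝ) + 1)),
      (fun y => G (N y) y) =ᶠ[𝓝 z] G n := by
    intro n z hz
    filter_upwards [Metric.isOpen_ball.mem_nhds hz] with y hy
    exact hagree _ _ y ⟨hN y, hy⟩
  exact ⟨fun y => G (N y) y, (hloc 0 w₀ (Metric.mem_ball_self (hpos 0))).trans (hG 0),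
    fun w => (hd _ w (hN w)).congr (hloc _ w (hN w)).symm⟩

/-- Every point of `S` is a value of a global developing map. -/
lemma exists_global_developing [T2Space S] [CompactSpace S] (hF : F.ProngsLeTwo) (x : S) :
    ∃ E : ℂ → S, E 0 = x ∧ ∀ w, F.IsDevelopingAt E w := by
  obtain ⟨E, hE, hd⟩ :=
    (eventually_isDevelopingAt_orbifoldChart hF x).self_of_nhds.exists_global hF
  exact ⟨E, hE.self_of_nhds.trans (orbifoldChart_zero hF x), hd⟩

/-- Global developing maps with a common value differ by a map `z ↦ ± z + c`. -/
lemma eq_comp_affine_of_isDevelopingAt [T2Space S] (hF : F.ProngsLeTwo) {E₁ E₂ : ℂ → S}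
    (h₁ : ∀ w, F.IsDevelopingAt E₁ w) (h₂ : ∀ w, F.IsDevelopingAt E₂ w) {w₁ w₂ : ℂ}
    (h : E₁ w₁ = E₂ w₂) :
    ∃ ε c : ℂ, (ε = 1 ∨ ε = -1) ∧ w₂ = ε * w₁ + c ∧ ∀ z, E₁ z = E₂ (ε * z + c) := by
  obtain ⟨ε, hε, he⟩ := (h₁ w₁).eventuallyEq_affine (h₂ w₂) h
  refine ⟨ε, w₂ - ε * w₁, hε, by ring, fun z => ?_⟩
  exact (eqOn_of_isDevelopingAt hF isPreconnected_univ (fun w _ => h₁ w)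
    (fun w _ => IsDevelopingAt.comp_affine hε (h₂ _)) (mem_univ w₁) he z
    (mem_univ z)).self_of_nhds

/-- A developing map takes neighbourhoods of `w` onto neighbourhoods of `E w`. -/
lemma IsDevelopingAt.eventually_exists_eq (hF : F.ProngsLeTwo) {E : ℂ → S} {w : ℂ}
    (h : F.IsDevelopingAt E w) {s : Set ℂ} (hs : s ∈ 𝓝 w) : ∀ᶠ y in 𝓝 (E w), ∃ z ∈ s, E z = y := by
  obtain ⟨ε, hε, h⟩ := h
  have hεε : ε * ε = 1 := by rcases hε with rfl | rfl <;> norm_num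
  have h1 : Tendsto (fun z : ℂ => ε * z + w) (𝓝 0) (𝓝 w) := by
    have : Continuous fun z : ℂ => ε * z + w := by fun_prop
    simpa using this.tendsto 0
  have h2 := h1.eventually (inter_mem hs h)
  filter_upwards [eventually_exists_orbifoldChart_eq hF (E w) h2] with y hy
  obtain ⟨z, ⟨hz1, hz2⟩, hzy⟩ := hy
  refine ⟨_, hz1, ?_⟩
  rw [mem_ofPred_eq] at hz2
  rw [hz2, ← hzy]
  congr 1
  linear_combination z * hεε

lemma IsDevelopingAt.eventually_ne (hF : F.ProngsLeTwo) {E : ℂ → S} {w : ℂ}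
    (h : F.IsDevelopingAt E w) : ∀ᶠ z in 𝓝[≠] w, E z ≠ E w := by
  obtain ⟨ε, hε, h⟩ := h
  have ht := (tendsto_sign_mul_sub ε w).eventually (eventually_zero_pow_mem_target hF (E w))
  filter_upwards [(h.and ht).filter_mono nhdsWithin_le_nhds, eventually_mem_nhdsWithin]
    with z ⟨h1, h2⟩ hz h3
  have h4 := F.chart_orbifoldChart _ h2
  rw [← h1, h3, F.chart_self] at h4
  have h5 := pow_eq_zero_iff (two_div_prongs_ne_zero hF (E w)) |>.1 h4.symm
  have h6 : ε ≠ 0 := by rcases hε with rfl | rfl <;> simp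
  exact hz (sub_eq_zero.1 ((mul_eq_zero.1 h5).resolve_left h6))

end FoliationPair

/-! ### The hyperspace of continua -/

namespace Continuum

lemma ext_carrier {X : Type*} [TopologicalSpace X] {A B : Continuum X}
    (h : A.carrier = B.carrier) : A = B :=
  Subtype.ext (SetLike.coe_injective h)

lemma isClosed_carrier {X : Type*} [TopologicalSpace X] [T2Space X] (A : Continuum X) :
    IsClosed A.carrier :=
  A.1.isCompact.isClosed

lemma dist_le_of_mem_dist {X : Type*} [MetricSpace X] {A B : Continuum X} {r : ℝ} (hr : 0 ≤ r)
    (h₁ : ∀ x ∈ A.carrier, ∃ y ∈ B.carrier, dist x y ≤ r)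
    (h₂ : ∀ x ∈ B.carrier, ∃ y ∈ A.carrier, dist x y ≤ r) : dist A B ≤ r := by
  rw [Subtype.dist_eq, Metric.NonemptyCompacts.dist_eq]
  exact Metric.hausdorffDist_le_of_mem_dist hr h₁ h₂

lemma exists_dist_lt_of_dist_lt {X : Type*} [MetricSpace X] {A B : Continuum X} {r : ℝ}
    (h : dist A B < r) {x : X} (hx : x ∈ A.carrier) : ∃ y ∈ B.carrier, dist x y < r := by
  rw [Subtype.dist_eq, Metric.NonemptyCompacts.dist_eq] at h
  exact Metric.exists_dist_lt_of_hausdorffDist_lt hx h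
    (Metric.hausdorffEDist_ne_top_of_nonempty_of_bounded A.1.nonempty B.1.nonempty
      A.1.isCompact.isBounded B.1.isCompact.isBounded)

lemma image_mul {X : Type*} [TopologicalSpace X] (f g : X ≃ₜ X) (A : Continuum X) :
    A.image (f * g) = (A.image g).image f :=
  ext_carrier (image_comp f g A.carrier)

end Continuum

/-! ### Flat covers -/

/-- A flat (orbifold) covering of `S` by the plane: an open continuous surjection whose
fibres are the orbits of a group of maps `z ↦ ± z + c`, acting discretely. -/
structure IsFlatCover {S : Type*} [TopologicalSpace S] (E : ℂ → S) : Prop where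
  continuous : Continuous E
  isOpenMap : IsOpenMap E
  surjective : Function.Surjective E
  deck : ∀ w w', E w = E w' →
    ∃ ε c : ℂ, (ε = 1 ∨ ε = -1) ∧ w' = ε * w + c ∧ ∀ u, E (ε * u + c) = E u
  isolated : ∀ w, ∀ᶠ z in 𝓝[≠] w, E z ≠ E w

/-- The group of translations of the plane that leave `E` invariant. -/
def periods {S : Type*} (E : ℂ → S) : AddSubgroup ℂ where
  carrier := {c | ∀ u, E (u + c) = E u}
  add_mem' := fun {a b} ha hb u => by rw [← add_assoc, hb, ha]
  zero_mem' := fun u => by rw [add_zero]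
  neg_mem' := fun {a} ha u => by rw [← ha (u + -a), neg_add_cancel_right]

/-- `g` is an affine lift of the homeomorphism `k` to the plane, expanding the horizontal
direction by the factor `|a|` and contracting the vertical one by the factor `|b|`. -/
structure IsExpandingLift {S : Type*} [TopologicalSpace S] (E : ℂ → S) (k : S ≃ₜ S) (g : ℂ → ℂ)
    (a b : ℝ) : Prop where
  semiconj : ∀ w, k (E w) = E (g w)
  map_add : ∀ w h, g (w + h) = g w + ⟨a * h.re, b * h.im⟩
  one_lt : 1 < |a|
  lt_one : |b| < 1
  ne_zero : b ≠ 0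

/-- The continuum that is the image of the horizontal segment from `w` to `w + l`. The length `l` may
have any sign, so that these continua are permuted by the lifts of a pseudo-Anosov map. -/
def arc {S : Type*} [TopologicalSpace S] {E : ℂ → S} (hE : Continuous E) (w : ℂ) (l : ℝ) :
    Continuum S :=
  ⟨⟨⟨(fun t : ℝ => E (w + (t * l : ℝ))) '' Icc 0 1, isCompact_Icc.image (by fun_prop)⟩,
    (nonempty_Icc.2 zero_le_one).image _⟩,
    (isConnected_Icc zero_le_one).image _
      (by fun_prop : Continuous fun t : ℝ => E (w + (t * l : ℝ))).continuousOn⟩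

/-- The continua contained in the image of a horizontal line. -/
def horizontalContinua {S : Type*} [TopologicalSpace S] (E : ℂ → S) : Set (Continuum S) :=
  {A | ∃ w, A.carrier ⊆ range fun t : ℝ => E (w + t)}

section Arc

variable {S : Type*} [TopologicalSpace S] {E : ℂ → S} (hE : Continuous E)

lemma carrier_arc (w : ℂ) (l : ℝ) :
    (arc hE w l).carrier = (fun t : ℝ => E (w + (t * l : ℝ))) '' Icc 0 1 := rfl

lemma mem_arc {w : ℂ} {l : ℝ} (hl : 0 ≤ l) {x : S} :
    x ∈ (arc hE w l).carrier ↔ ∃ t ∈ Icc 0 l, E (w + (t : ℝ)) = x := by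
  rw [carrier_arc]
  constructor
  · rintro ⟨t, ht, rfl⟩
    exact ⟨t * l, ⟨mul_nonneg ht.1 hl, mul_le_of_le_one_left hl ht.2⟩, rfl⟩
  · rintro ⟨t, ht, rfl⟩
    rcases hl.eq_or_lt with rfl | hl
    · refine ⟨0, by simp, ?_⟩
      simp [le_antisymm ht.2 ht.1]
    · refine ⟨t / l, ⟨div_nonneg ht.1 hl.le, (div_le_one hl).2 ht.2⟩, ?_⟩
      simp only [div_mul_cancel₀ _ hl.ne']

lemma arc_subset_arc {w : ℂ} {t l m : ℝ} (ht : 0 ≤ t) (hl : 0 ≤ l) (h : t + l ≤ m) :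
    (arc hE (w + t) l).carrier ⊆ (arc hE w m).carrier := by
  intro x hx
  obtain ⟨s, hs, rfl⟩ := (mem_arc hE hl).1 hx
  refine (mem_arc hE (by linarith)).2 ⟨t + s, ⟨by linarith [hs.1], by linarith [hs.2]⟩, ?_⟩
  rw [Complex.ofReal_add, add_assoc]

lemma arc_reverse (w : ℂ) (l : ℝ) : arc hE w l = arc hE (w + l) (-l) := by
  apply Continuum.ext_carrier
  rw [carrier_arc, carrier_arc]
  apply Subset.antisymm
  all_goals
    rintro _ ⟨t, ht, rfl⟩
    refine ⟨1 - t, ⟨by linarith [ht.2], by linarith [ht.1]⟩, ?_⟩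
    dsimp only
    congr 1
    push_cast
    ring

lemma exists_arc_abs (w : ℂ) (l : ℝ) : ∃ w', arc hE w l = arc hE w' |l| := by
  rcases le_total 0 l with h | h
  · exact ⟨w, by rw [abs_of_nonneg h]⟩
  · exact ⟨w + l, by rw [abs_of_nonpos h, arc_reverse]⟩

lemma arc_add_period {c : ℂ} (hc : c ∈ periods E) (w : ℂ) (l : ℝ) :
    arc hE (w + c) l = arc hE w l := by
  apply Continuum.ext_carrier
  rw [carrier_arc, carrier_arc]
  congr 1
  funext t
  rw [add_right_comm, hc]

lemma arc_mem_horizontalContinua (w : ℂ) (l : ℝ) : arc hE w l ∈ horizontalContinua E := by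
  refine ⟨w, ?_⟩
  rintro _ ⟨t, -, rfl⟩
  exact ⟨t * l, rfl⟩

lemma image_arc {k : S ≃ₜ S} {g : ℂ → ℂ} {a b : ℝ} (hk : IsExpandingLift E k g a b) (w : ℂ)
    (l : ℝ) : (arc hE w l).image k = arc hE (g w) (a * l) := by
  apply Continuum.ext_carrier
  change k '' (arc hE w l).carrier = _
  rw [carrier_arc, carrier_arc, ← image_comp]
  congr 1
  funext t
  rw [Function.comp_apply, hk.semiconj, hk.map_add]
  congr 2
  apply Complex.ext
  · simp
    ring
  · simp

lemma exists_image_pow_arc {k : S ≃ₜ S} {g : ℂ → ℂ} {a b : ℝ} (hk : IsExpandingLift E k g a b)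
    (w : ℂ) (l : ℝ) (n : ℕ) : ∃ w', (arc hE w l).image (k ^ n) = arc hE w' (a ^ n * l) := by
  induction n with
  | zero =>
    refine ⟨w, Continuum.ext_carrier ?_⟩
    rw [pow_zero, pow_zero, one_mul]
    exact image_id _
  | succ n ih =>
    obtain ⟨w', hw'⟩ := ih
    refine ⟨g w', ?_⟩
    rw [pow_succ', Continuum.image_mul, hw', image_arc hE hk, pow_succ', mul_assoc]

end Arc

/-! ### Long horizontal segments are almost dense -/

namespace IsFlatCover

variable {S : Type*}

lemma exists_period_near [TopologicalSpace S] [CompactSpace S] {E : ℂ → S} (hE : IsFlatCover E) :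
    ∃ R > 0, ∀ w, ∃ c ∈ periods E, ‖w - c‖ ≤ R := by
  obtain ⟨n, hn⟩ := isCompact_univ.elim_directed_cover
    (fun n : ℕ => E '' Metric.ball (0 : ℂ) n) (fun n => hE.isOpenMap _ Metric.isOpen_ball)
    (by
      intro x _
      obtain ⟨w, rfl⟩ := hE.surjective x
      obtain ⟨n, hn⟩ := exists_nat_gt ‖w‖
      exact mem_iUnion.2 ⟨n, w, mem_ball_zero_iff.2 hn, rfl⟩)
    (Monotone.directed_le fun a b hab =>
      image_mono (Metric.ball_subset_ball (by exact_mod_cast hab)))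
  -- `c₀` is the constant of some deck transformation `z ↦ - z + c₀`, if there is one
  obtain ⟨c₀, hc₀⟩ : ∃ c₀ : ℂ, ∀ c : ℂ, (∀ u, E (-1 * u + c) = E u) → c - c₀ ∈ periods E := by
    by_cases h : ∃ c₀ : ℂ, ∀ u, E (-1 * u + c₀) = E u
    · obtain ⟨c₀, h⟩ := h
      refine ⟨c₀, fun c hc u => ?_⟩
      rw [← h u, ← hc]
      congr 1
      ring
    · exact ⟨0, fun c hc => absurd ⟨c, hc⟩ h⟩
  refine ⟨n + ‖c₀‖ + 1, by positivity, fun w => ?_⟩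
  obtain ⟨w', hw', he⟩ := hn (mem_univ (E w))
  rw [mem_ball_zero_iff] at hw'
  obtain ⟨ε, c, hε, rfl, hc⟩ := hE.deck w' w he
  rcases hε with rfl | rfl
  · refine ⟨c, fun u => by rw [← hc u, one_mul], ?_⟩
    rw [one_mul, add_sub_cancel_right]
    linarith [norm_nonneg c₀]
  · refine ⟨c - c₀, hc₀ c hc, ?_⟩
    have : -1 * w' + c - (c - c₀) = c₀ - w' := by ring
    rw [this]
    linarith [norm_sub_le c₀ w']

lemma map_mem_periods [TopologicalSpace S] {E : ℂ → S} {k : S ≃ₜ S}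
    {g : ℂ → ℂ} {a b : ℝ} (hk : IsExpandingLift E k g a b) {c : ℂ} :
    (⟨a * c.re, b * c.im⟩ : ℂ) ∈ periods E ↔ c ∈ periods E := by
  have ha : a ≠ 0 := by
    rintro rfl
    have := hk.one_lt
    norm_num at this
  have hsurj : ∀ u, ∃ w, g w = u := by
    intro u
    refine ⟨0 + ⟨(u - g 0).re / a, (u - g 0).im / b⟩, ?_⟩
    rw [hk.map_add]
    apply Complex.ext
    · simp [mul_div_cancel₀ _ ha]
    · simp [mul_div_cancel₀ _ hk.ne_zero]
  constructor
  · intro hc u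
    apply k.injective
    rw [hk.semiconj, hk.semiconj, hk.map_add, hc]
  · intro hc u
    obtain ⟨w, rfl⟩ := hsurj u
    rw [← hk.map_add, ← hk.semiconj, hc, hk.semiconj]

lemma div_pow_mem_periods [TopologicalSpace S] {E : ℂ → S} {k : S ≃ₜ S}
    {g : ℂ → ℂ} {a b : ℝ} (hk : IsExpandingLift E k g a b) {c : ℂ} (hc : c ∈ periods E)
    (n : ℕ) : (⟨c.re / a ^ n, c.im / b ^ n⟩ : ℂ) ∈ periods E := by
  have ha : a ≠ 0 := by
    rintro rfl
    have := hk.one_lt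
    norm_num at this
  have hb := hk.ne_zero
  induction n with
  | zero => simpa using hc
  | succ n ih =>
    rw [← map_mem_periods hk]
    convert ih using 2
    all_goals
      field_simp
      ring

/-- There are no horizontal periods: the inverse of the expanding map would contract them. -/
lemma eq_zero_of_mem_periods [TopologicalSpace S] {E : ℂ → S} (hE : IsFlatCover E) {k : S ≃ₜ S}
    {g : ℂ → ℂ} {a b : ℝ} (hk : IsExpandingLift E k g a b) {c : ℂ} (hc : c ∈ periods E)
    (him : c.im = 0) : c = 0 := by
  by_contra hc0
  have hre : c.re ≠ 0 := fun h => hc0 (Complex.ext h him)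
  have ha : a ≠ 0 := by
    rintro rfl
    have := hk.one_lt
    norm_num at this
  have h1 := hE.isolated 0
  rw [eventually_nhdsWithin_iff, Metric.eventually_nhds_iff] at h1
  obtain ⟨ρ, hρ, h1⟩ := h1
  obtain ⟨n, hn⟩ := pow_unbounded_of_one_lt (|c.re| / ρ) hk.one_lt
  have h2 : (⟨c.re / a ^ n, c.im / b ^ n⟩ : ℂ) = ((c.re / a ^ n : ℝ) : ℂ) := by
    apply Complex.ext
    · rw [Complex.ofReal_re]
    · rw [Complex.ofReal_im, him, zero_div]
  have h3 := div_pow_mem_periods hk hc n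
  rw [h2] at h3
  refine h1 (y := ((c.re / a ^ n : ℝ) : ℂ)) ?_ ?_ ?_
  · rw [dist_zero_right, Complex.norm_real, Real.norm_eq_abs, abs_div, abs_pow]
    rw [div_lt_iff₀ hρ] at hn
    rw [div_lt_iff₀ (by have := hk.one_lt; positivity)]
    linarith
  · simp only [mem_compl_iff, mem_singleton_iff, Complex.ofReal_eq_zero]
    exact div_ne_zero hre (pow_ne_zero _ ha)
  · have := h3 0
    rwa [zero_add] at this

/-- The heights of the periods are dense in the line: they form a subgroup that is invariant
under a contraction, so it is not cyclic. -/
lemma dense_im_periods [TopologicalSpace S] [CompactSpace S] {E : ℂ → S} (hE : IsFlatCover E)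
    {k : S ≃ₜ S} {g : ℂ → ℂ} {a b : ℝ} (hk : IsExpandingLift E k g a b) :
    Dense (Complex.im '' (periods E : Set ℂ)) := by
  rcases AddSubgroup.dense_or_cyclic ((periods E).map Complex.imAddGroupHom) with h | ⟨d, hd⟩
  · exact h
  exfalso
  obtain ⟨c, hc, hcd⟩ : d ∈ (periods E).map Complex.imAddGroupHom := by
    rw [hd]
    exact AddSubgroup.mem_closure_singleton_self d
  have h1 : b * d ∈ (periods E).map Complex.imAddGroupHom := by
    refine ⟨⟨a * c.re, b * c.im⟩, (map_mem_periods hk).2 hc, ?_⟩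
    rw [← hcd]
    rfl
  rw [hd] at h1
  obtain ⟨m, hm⟩ := AddSubgroup.mem_closure_singleton.1 h1
  have hd0 : d = 0 := by
    by_contra hd0
    rw [zsmul_eq_mul] at hm
    have hmb : (m : ℝ) = b := mul_right_cancel₀ hd0 hm
    have h2 := hk.lt_one
    rw [← hmb, ← Int.cast_abs, ← Int.cast_one, Int.cast_lt, Int.abs_lt_one_iff] at h2
    apply hk.ne_zero
    rw [← hmb, h2, Int.cast_zero]
  obtain ⟨R, hR, hper⟩ := hE.exists_period_near
  obtain ⟨c', hc', hR'⟩ := hper ((R + 1 : ℝ) : ℂ)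
  have h3 : c'.im ∈ (periods E).map Complex.imAddGroupHom := ⟨c', hc', rfl⟩
  rw [hd, hd0, AddSubgroup.closure_singleton_zero, AddSubgroup.mem_bot] at h3
  rw [hE.eq_zero_of_mem_periods hk hc' h3, sub_zero, Complex.norm_real, Real.norm_eq_abs,
    abs_of_pos (by linarith)] at hR'
  linarith

/-- All long horizontal segments come close to all points modulo periods, uniformly. -/
lemma exists_length_near [TopologicalSpace S] [CompactSpace S] {E : ℂ → S} (hE : IsFlatCover E)
    {k : S ≃ₜ S} {g : ℂ → ℂ} {a b : ℝ} (hk : IsExpandingLift E k g a b) {δ : ℝ} (hδ : 0 < δ) :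
    ∃ L > 0, ∀ w w' : ℂ, ∃ c ∈ periods E, ∃ t ∈ Icc 0 L, dist (w' + c) (w + (t : ℝ)) < δ := by
  obtain ⟨R, hR, hper⟩ := hE.exists_period_near
  obtain ⟨T, hT⟩ := (isCompact_Icc (a := -R) (b := R)).elim_finite_subcover
    (fun c : periods E => Metric.ball (-(c : ℂ).im) δ) (fun c => Metric.isOpen_ball) (by
      intro y _
      obtain ⟨_, ⟨c, hc, rfl⟩, hyc⟩ := (hE.dense_im_periods hk).exists_dist_lt (-y) hδ
      refine mem_iUnion.2 ⟨⟨c, hc⟩, ?_⟩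
      rw [Metric.mem_ball, ← dist_neg_neg, neg_neg]
      exact hyc)
  set M : ℝ := R + ∑ c ∈ T, |(c : ℂ).re| with hM
  have hM0 : 0 < M := by
    have : 0 ≤ ∑ c ∈ T, |(c : ℂ).re| := Finset.sum_nonneg fun c _ => abs_nonneg _
    linarith
  have key : ∀ z : ℂ, ∃ c ∈ periods E, |(z + c).re| ≤ M ∧ |(z + c).im| < δ := by
    intro z
    obtain ⟨c₀, hc₀, hz⟩ := hper z
    have him : (z - c₀).im ∈ Icc (-R) R := abs_le.1 ((Complex.abs_im_le_norm _).trans hz)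
    obtain ⟨c, hcT, hc⟩ := mem_iUnion₂.1 (hT him)
    refine ⟨c - c₀, sub_mem c.2 hc₀, ?_, ?_⟩
    · have h1 : z + (c - c₀) = (z - c₀) + c := by ring
      rw [h1, Complex.add_re]
      have h2 : |(c : ℂ).re| ≤ ∑ c ∈ T, |(c : ℂ).re| :=
        Finset.single_le_sum (f := fun c : periods E => |(c : ℂ).re|)
          (fun c _ => abs_nonneg _) hcT
      exact (abs_add_le _ _).trans (add_le_add ((Complex.abs_re_le_norm _).trans hz) h2)
    · have h1 : z + (c - c₀) = (z - c₀) + c := by ring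
      rw [h1, Complex.add_im]
      rwa [Metric.mem_ball, Real.dist_eq, sub_neg_eq_add] at hc
  refine ⟨2 * M, by linarith, fun w w' => ?_⟩
  obtain ⟨c, hc, h1, h2⟩ := key (w' - w - (M : ℝ))
  rw [abs_le] at h1
  refine ⟨c, hc, M + (w' - w - (M : ℝ) + c).re, ⟨by linarith, by linarith⟩, ?_⟩
  rw [dist_eq_norm]
  have h3 : w' + c - (w + ((M + (w' - w - (M : ℝ) + c).re : ℝ) : ℂ)) =
      ((w' - w - (M : ℝ) + c).im : ℝ) * Complex.I := by
    apply Complex.ext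
    · simp
      ring
    · simp
      ring
  rw [h3, norm_mul, Complex.norm_I, mul_one, Complex.norm_real, Real.norm_eq_abs]
  exact h2

lemma countable_fiber [TopologicalSpace S] {E : ℂ → S} (hE : IsFlatCover E) (x : S) :
    (E ⁻¹' {x}).Countable := by
  apply (HereditarilyLindelofSpace.isLindelof (E ⁻¹' {x})).countable_of_isDiscrete
  rw [isDiscrete_iff_nhdsNE]
  intro w hw
  rw [← disjoint_iff, disjoint_principal_right]
  filter_upwards [hE.isolated w] with z hz hzx
  exact hz (hzx.trans hw.symm)

/-- The heights of the lifts of a horizontal line form a countable set. -/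
lemma im_mem_of_eq [TopologicalSpace S] {E : ℂ → S} (hE : IsFlatCover E) {w₀ u : ℂ}
    (hu : E u ∈ range fun t : ℝ => E (w₀ + t)) : u.im ∈ Complex.im '' (E ⁻¹' {E w₀}) := by
  obtain ⟨t, ht⟩ := hu
  obtain ⟨ε, c, hε, rfl, hc⟩ := hE.deck _ _ ht
  refine ⟨ε * w₀ + c, hc w₀, ?_⟩
  rcases hε with rfl | rfl <;> simp

section Metric

variable [MetricSpace S] {E : ℂ → S}

lemma uniformContinuous [CompactSpace S] (hE : IsFlatCover E) : UniformContinuous E := by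
  obtain ⟨R, hR, hper⟩ := hE.exists_period_near
  have h1 := (isCompact_closedBall (0 : ℂ) (R + 1)).uniformContinuousOn_of_continuous
    hE.continuous.continuousOn
  rw [Metric.uniformContinuousOn_iff] at h1
  rw [Metric.uniformContinuous_iff]
  intro ε hε
  obtain ⟨δ, hδ, h1⟩ := h1 ε hε
  refine ⟨min δ 1, lt_min hδ one_pos, fun {w w'} hww' => ?_⟩
  obtain ⟨c, hc, hwc⟩ := hper w
  have h2 : ∀ u, E (u - c) = E u := fun u => by rw [← hc (u - c), sub_add_cancel]
  rw [← h2 w, ← h2 w']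
  apply h1
  · rw [mem_closedBall_zero_iff]
    linarith
  · rw [mem_closedBall_zero_iff]
    have h3 : w' - c = (w - c) - (w - w') := by ring
    rw [h3]
    have h4 := norm_sub_le (w - c) (w - w')
    rw [dist_eq_norm] at hww'
    linarith [hww'.trans_le (min_le_right _ _)]
  · rw [dist_sub_right]
    exact hww'.trans_le (min_le_left _ _)

lemma dist_arc_le (hE : Continuous E) {δ ε : ℝ} (hε : 0 ≤ ε)
    (hδ : ∀ u v, dist u v < δ → dist (E u) (E v) < ε) {w w' : ℂ} {l l' : ℝ}
    (h : dist w w' + dist l l' < δ) : dist (arc hE w l) (arc hE w' l') ≤ ε := by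
  have key : ∀ t ∈ Icc (0 : ℝ) 1,
      dist (E (w + (t * l : ℝ))) (E (w' + (t * l' : ℝ))) < ε := by
    intro t ht
    apply hδ
    refine lt_of_le_of_lt ((dist_add_add_le _ _ _ _).trans (add_le_add_right ?_ _)) h
    rw [Complex.dist_eq, ← Complex.ofReal_sub, Complex.norm_real, Real.norm_eq_abs, ← mul_sub,
      abs_mul, abs_of_nonneg ht.1, ← Real.dist_eq]
    exact mul_le_of_le_one_left dist_nonneg ht.2
  apply Continuum.dist_le_of_mem_dist hε
  · rintro _ ⟨t, ht, rfl⟩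
    exact ⟨_, ⟨t, ht, rfl⟩, (key t ht).le⟩
  · rintro _ ⟨t, ht, rfl⟩
    refine ⟨_, ⟨t, ht, rfl⟩, ?_⟩
    rw [dist_comm]
    exact (key t ht).le

lemma continuous_arc [CompactSpace S] (hE : IsFlatCover E) :
    Continuous fun p : ℂ × ℝ => arc hE.continuous p.1 p.2 := by
  apply UniformContinuous.continuous
  rw [Metric.uniformContinuous_iff]
  intro ε hε
  obtain ⟨δ, hδ, h⟩ := Metric.uniformContinuous_iff.1 hE.uniformContinuous (ε / 2) (half_pos hε)
  refine ⟨δ / 2, half_pos hδ, fun {p q} hpq => ?_⟩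
  have h1 := (le_max_left _ _).trans_lt (Prod.dist_eq.symm.trans_lt hpq)
  have h2 := (le_max_right _ _).trans_lt (Prod.dist_eq.symm.trans_lt hpq)
  refine (dist_arc_le hE.continuous (half_pos hε).le (fun u v => @h u v) ?_).trans_lt
    (half_lt_self hε)
  linarith

variable {k : S ≃ₜ S} {g : ℂ → ℂ} {a b : ℝ}

/-- Long arcs of horizontal leaves are almost dense in `S`, uniformly. -/
lemma exists_length_arc_near [CompactSpace S] (hE : IsFlatCover E)
    (hk : IsExpandingLift E k g a b) {ε : ℝ}
    (hε : 0 < ε) : ∃ L > 0, ∀ w : ℂ, ∀ l ≥ L, ∀ x, ∃ y ∈ (arc hE.continuous w l).carrier,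
      dist x y < ε := by
  obtain ⟨δ, hδ, h⟩ := Metric.uniformContinuous_iff.1 hE.uniformContinuous ε hε
  obtain ⟨L, hL, hnear⟩ := hE.exists_length_near hk hδ
  refine ⟨L, hL, fun w l hl x => ?_⟩
  obtain ⟨w', rfl⟩ := hE.surjective x
  obtain ⟨c, hc, t, ht, hd⟩ := hnear w w'
  refine ⟨E (w + t), (mem_arc _ (by linarith)).2 ⟨t, ⟨ht.1, ht.2.trans hl⟩, rfl⟩, ?_⟩
  rw [← hc w']
  exact h hd

lemma exists_length_dist_whole_le [CompactSpace S] [ConnectedSpace S] (hE : IsFlatCover E)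
    (hk : IsExpandingLift E k g a b) {ε : ℝ} (hε : 0 < ε) :
    ∃ L > 0, ∀ w : ℂ, ∀ l ≥ L, dist (arc hE.continuous w l) (Continuum.whole S) ≤ ε := by
  obtain ⟨L, hL, h⟩ := hE.exists_length_arc_near hk hε
  refine ⟨L, hL, fun w l hl => Continuum.dist_le_of_mem_dist hε.le ?_ ?_⟩
  · exact fun x _ => ⟨x, mem_univ x, by rw [dist_self]; exact hε.le⟩
  · intro x _
    obtain ⟨y, hy, hxy⟩ := h w l hl x
    exact ⟨y, hy, hxy.le⟩

/-! ### Continua inside horizontal leaves are arcs -/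

/-- A continuum in a horizontal leaf does not contain arbitrarily long arcs, because these are
almost dense, whereas a leaf meets vertical lines in countable sets. -/
lemma exists_not_arc_subset [CompactSpace S] (hE : IsFlatCover E) (hk : IsExpandingLift E k g a b)
    {C : Continuum S} (hC : C ∈ horizontalContinua E) :
    ∃ L, ∀ w : ℂ, ∀ l ≥ L, ¬ (arc hE.continuous w l).carrier ⊆ C.carrier := by
  by_contra! hcon
  obtain ⟨w₀, hw₀⟩ := hC
  have huniv : ∀ x, x ∈ C.carrier := by
    intro x
    rw [← C.isClosed_carrier.closure_eq, Metric.mem_closure_iff]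
    intro ε hε
    obtain ⟨L, -, h⟩ := hE.exists_length_arc_near hk hε
    obtain ⟨w, l, hl, hs⟩ := hcon L
    obtain ⟨y, hy, hxy⟩ := h w l hl x
    exact ⟨y, hs hy, hxy⟩
  have h1 : (univ : Set ℝ) ⊆ Complex.im '' (E ⁻¹' {E w₀}) := by
    intro y _
    exact hE.im_mem_of_eq (u := ⟨0, y⟩) (hw₀ (huniv _))
  exact Set.not_countable_univ ((((hE.countable_fiber (E w₀)).image _)).mono h1)

/-- A thin rectangle around a horizontal segment whose end points are outside the continuum `C`
may be chosen with boundary mapped outside `C`: then its image contains `C`. -/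
lemma subset_image_rectangle (hE : IsFlatCover E) {C : Continuum S}
    (hC : C ∈ horizontalContinua E) {w : ℂ} (hw : E w ∈ C.carrier) {s t δ : ℝ} (hs : s < 0)
    (ht : 0 < t) (hsC : E (w + s) ∉ C.carrier) (htC : E (w + t) ∉ C.carrier) (hδ : 0 < δ) :
    ∀ x ∈ C.carrier, ∃ z : ℂ, E (w + z) = x ∧ z.re ∈ Icc s t ∧ |z.im| ≤ δ := by
  obtain ⟨w₀, hw₀⟩ := hC
  have hclosed : ∀ v : ℝ, E (w + v) ∉ C.carrier →
      ∃ η > 0, ∀ y : ℝ, |y| < η → E (w + ⟨v, y⟩) ∉ C.carrier := by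
    intro v hv
    have hcont : Continuous fun y : ℝ => E (w + ⟨v, y⟩) := by
      have : Continuous fun y : ℝ => (⟨v, y⟩ : ℂ) :=
        Complex.equivRealProdCLM.symm.continuous.comp (Continuous.prodMk_right v)
      have hE' := hE.continuous
      fun_prop
    have h1 : ∀ᶠ y in 𝓝 (0 : ℝ), E (w + ⟨v, y⟩) ∉ C.carrier :=
      hcont.continuousAt.eventually (C.isClosed_carrier.isOpen_compl.mem_nhds hv)
    obtain ⟨η, hη, h2⟩ := Metric.eventually_nhds_iff.1 h1
    exact ⟨η, hη, fun y hy => h2 (by rwa [Real.dist_0_eq_abs])⟩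
  obtain ⟨η₁, hη₁, h₁⟩ := hclosed s hsC
  obtain ⟨η₂, hη₂, h₂⟩ := hclosed t htC
  set η := min δ (min η₁ η₂) with hη
  have hη0 : 0 < η := lt_min hδ (lt_min hη₁ hη₂)
  have hY : (Complex.im '' (E ⁻¹' {E w₀})).Countable := (hE.countable_fiber _).image _
  have hdense : Dense ((fun y : ℝ => y - w.im) '' (Complex.im '' (E ⁻¹' {E w₀})))ᶜ :=
    (hY.image _).dense_compl ℝ
  obtain ⟨p, hpY, hp⟩ := hdense.exists_mem_open isOpen_Ioo (nonempty_Ioo.2 (neg_lt_zero.2 hη0))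
  obtain ⟨q, hqY, hq⟩ := hdense.exists_mem_open isOpen_Ioo (nonempty_Ioo.2 hη0)
  have hlevel : ∀ z : ℂ, E (w + z) ∈ C.carrier →
      z.im ∈ (fun y : ℝ => y - w.im) '' (Complex.im '' (E ⁻¹' {E w₀})) := by
    intro z hz
    refine ⟨_, hE.im_mem_of_eq (hw₀ hz), ?_⟩
    simp
  set f : ℂ → S := fun z => E (w + z) with hf
  have hfc : Continuous f := hE.continuous.comp (continuous_const.add continuous_id)
  have hfo : IsOpenMap f := hE.isOpenMap.comp (isOpenMap_add_left w)
  set U : Set S := f '' (Ioo s t ×ℂ Ioo p q) with hU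
  have hUo : IsOpen U := hfo _ (isOpen_Ioo.reProdIm isOpen_Ioo)
  have hK : IsClosed (f '' (Icc s t ×ℂ Icc p q)) :=
    ((isCompact_Icc.reProdIm isCompact_Icc).image hfc).isClosed
  have hpη : |p| < η := by rw [abs_lt]; exact ⟨hp.1, by linarith [hp.2]⟩
  have hqη : |q| < η := by rw [abs_lt]; exact ⟨by linarith [hq.1], hq.2⟩
  have hsub : C.carrier ⊆ U := by
    refine C.2.isPreconnected.subset_of_closure_inter_subset hUo ⟨E w, hw, 0, ?_, by simp [hf]⟩ ?_
    · rw [Complex.mem_reProdIm]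
      exact ⟨⟨hs, ht⟩, ⟨hp.2, hq.1⟩⟩
    rintro x ⟨hxU, hxC⟩
    have hxC : x ∈ C.carrier := hxC
    have hxK : x ∈ f '' (Icc s t ×ℂ Icc p q) := by
      refine closure_minimal (image_mono ?_) hK hxU
      intro z hz
      rw [Complex.mem_reProdIm] at *
      exact ⟨Ioo_subset_Icc_self hz.1, Ioo_subset_Icc_self hz.2⟩
    obtain ⟨z, hz, rfl⟩ := hxK
    rw [Complex.mem_reProdIm] at hz
    have hzp : z.im ≠ p := fun h => hpY (h ▸ hlevel z hxC)
    have hzq : z.im ≠ q := fun h => hqY (h ▸ hlevel z hxC)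
    have hzη : |z.im| < η :=
      abs_lt.2 ⟨hp.1.trans_le hz.2.1, hz.2.2.trans_lt hq.2⟩
    have hzs : z.re ≠ s := fun h =>
      h₁ z.im (hzη.trans_le ((min_le_right _ _).trans (min_le_left _ _))) (h ▸ hxC)
    have hzt : z.re ≠ t := fun h =>
      h₂ z.im (hzη.trans_le ((min_le_right _ _).trans (min_le_right _ _))) (h ▸ hxC)
    refine ⟨z, Complex.mem_reProdIm.2 ⟨⟨?_, ?_⟩, ⟨?_, ?_⟩⟩, rfl⟩
    · exact lt_of_le_of_ne hz.1.1 hzs.symm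
    · exact lt_of_le_of_ne hz.1.2 hzt
    · exact lt_of_le_of_ne hz.2.1 hzp.symm
    · exact lt_of_le_of_ne hz.2.2 hzq
  intro x hx
  obtain ⟨z, hz, rfl⟩ := hsub hx
  rw [Complex.mem_reProdIm] at hz
  refine ⟨z, rfl, Ioo_subset_Icc_self hz.1, ?_⟩
  have : |z.im| < η := abs_lt.2 ⟨hp.1.trans hz.2.1, hz.2.2.trans hq.2⟩
  exact this.le.trans (min_le_left _ _)

/-- Every continuum in a horizontal leaf is an arc: its component `[s, t]` in the leaf has gaps of
the continuum arbitrarily close to both ends, so thin rectangles confine the continuum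
to `[s, t]`. -/
lemma exists_eq_arc [CompactSpace S] (hE : IsFlatCover E) (hk : IsExpandingLift E k g a b)
    {C : Continuum S} (hC : C ∈ horizontalContinua E) :
    ∃ w : ℂ, ∃ l ≥ 0, C = arc hE.continuous w l := by
  obtain ⟨L, hL⟩ := hE.exists_not_arc_subset hk hC
  obtain ⟨x₀, hx₀⟩ : C.carrier.Nonempty := C.1.nonempty
  obtain ⟨w, rfl⟩ := hE.surjective x₀
  set T : Set ℝ := {t | E (w + t) ∈ C.carrier} with hT
  have hTc : IsClosed T := by
    have h1 := hE.continuous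
    exact C.isClosed_carrier.preimage (by fun_prop : Continuous fun t : ℝ => E (w + t))
  have h0T : (0 : ℝ) ∈ T := by
    change E (w + (0 : ℝ)) ∈ C.carrier
    simpa using hx₀
  -- `[s, t]` is the connected component of `0` in `T`
  set s := sSup (Iic 0 ∩ Tᶜ) with hs
  set t := sInf (Ici 0 ∩ Tᶜ) with ht
  have hneL : (Iic 0 ∩ Tᶜ).Nonempty := by
    obtain ⟨x, hx, hxC⟩ := not_subset.1 (hL (w + ((-|L| : ℝ) : ℂ)) |L| (le_abs_self L))
    obtain ⟨r, hr, rfl⟩ := (mem_arc _ (abs_nonneg L)).1 hx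
    refine ⟨-|L| + r, ?_, ?_⟩
    · rw [mem_Iic]
      linarith [hr.2]
    · intro h
      apply hxC
      have h2 : E (w + ((-|L| + r : ℝ) : ℂ)) ∈ C.carrier := h
      rwa [Complex.ofReal_add, ← add_assoc] at h2
  have hneR : (Ici 0 ∩ Tᶜ).Nonempty := by
    obtain ⟨x, hx, hxC⟩ := not_subset.1 (hL w |L| (le_abs_self L))
    obtain ⟨r, hr, rfl⟩ := (mem_arc _ (abs_nonneg L)).1 hx
    exact ⟨r, hr.1, hxC⟩
  have hbL : BddAbove (Iic 0 ∩ Tᶜ) := ⟨0, fun r hr => hr.1⟩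
  have hbR : BddBelow (Ici 0 ∩ Tᶜ) := ⟨0, fun r hr => hr.1⟩
  have hs0 : s ≤ 0 := csSup_le hneL fun r hr => hr.1
  have ht0 : 0 ≤ t := le_csInf hneR fun r hr => hr.1
  have hIoc : ∀ r, s < r → r ≤ 0 → r ∈ T := by
    intro r hr hr0
    by_contra hrT
    exact absurd (le_csSup hbL ⟨hr0, hrT⟩) (not_le.2 hr)
  have hIco : ∀ r, 0 ≤ r → r < t → r ∈ T := by
    intro r hr0 hr
    by_contra hrT
    exact absurd (csInf_le hbR ⟨hr0, hrT⟩) (not_le.2 hr)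
  have hsT : s ∈ T := by
    rcases hs0.eq_or_lt with h | h
    · rwa [h]
    · refine hTc.closure_subset_iff.2 (fun r hr => hIoc r hr.1 hr.2.le : Ioo s 0 ⊆ T) ?_
      rw [closure_Ioo h.ne]
      exact left_mem_Icc.2 hs0
  have htT : t ∈ T := by
    rcases ht0.eq_or_lt with h | h
    · rwa [← h]
    · refine hTc.closure_subset_iff.2 (fun r hr => hIco r hr.1.le hr.2 : Ioo 0 t ⊆ T) ?_
      rw [closure_Ioo h.ne]
      exact right_mem_Icc.2 ht0
  have hIcc : ∀ r ∈ Icc s t, r ∈ T := by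
    intro r hr
    rcases hr.1.eq_or_lt with h | h
    · rwa [← h]
    rcases hr.2.eq_or_lt with h' | h'
    · rwa [h']
    rcases le_total r 0 with h0 | h0
    · exact hIoc r h h0
    · exact hIco r h0 h'
  have hl : 0 ≤ t - s := by linarith
  refine ⟨w + (s : ℝ), t - s, hl, Continuum.ext_carrier (Subset.antisymm ?_ ?_)⟩
  · intro x hx
    rw [← (arc hE.continuous (w + (s : ℝ)) (t - s)).isClosed_carrier.closure_eq,
      Metric.mem_closure_iff]
    intro ε hε
    obtain ⟨δ, hδ, huc⟩ := Metric.uniformContinuous_iff.1 hE.uniformContinuous ε hε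
    obtain ⟨s', hs'T, hs'⟩ := exists_lt_of_lt_csSup hneL (sub_lt_self s (by linarith : 0 < δ / 4))
    obtain ⟨t', ht'T, ht'⟩ := exists_lt_of_csInf_lt hneR (lt_add_of_pos_right t
      (by linarith : 0 < δ / 4))
    have hs'0 : s' < 0 := lt_of_le_of_ne hs'T.1 fun h => hs'T.2 (h ▸ h0T)
    have ht'0 : 0 < t' := lt_of_le_of_ne ht'T.1 fun h => ht'T.2 (h ▸ h0T)
    obtain ⟨z, rfl, hzre, hzim⟩ := hE.subset_image_rectangle hC hx₀ hs'0 ht'0 hs'T.2 ht'T.2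
      (by linarith : 0 < δ / 4) x hx
    -- the point of `[s, t]` closest to the real part of `z`
    obtain ⟨r, hr, hrz⟩ : ∃ r ∈ Icc s t, |z.re - r| ≤ δ / 4 := by
      rcases lt_or_ge z.re s with h | h
      · exact ⟨s, left_mem_Icc.2 (by linarith), abs_le.2 ⟨by linarith [hzre.1], by linarith⟩⟩
      rcases lt_or_ge t z.re with h' | h'
      · exact ⟨t, right_mem_Icc.2 (by linarith), abs_le.2 ⟨by linarith, by linarith [hzre.2]⟩⟩
      · exact ⟨z.re, ⟨h, h'⟩, by rw [sub_self, abs_zero]; linarith⟩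
    refine ⟨E (w + r), (mem_arc _ hl).2 ⟨r - s, ⟨by linarith [hr.1], by linarith [hr.2]⟩, ?_⟩, ?_⟩
    · congr 1
      push_cast
      ring
    · apply huc
      rw [dist_add_left, dist_eq_norm]
      refine (Complex.norm_le_abs_re_add_abs_im _).trans_lt ?_
      rw [Complex.sub_re, Complex.sub_im, Complex.ofReal_re, Complex.ofReal_im, sub_zero]
      linarith
  · intro x hx
    obtain ⟨r, hr, rfl⟩ := (mem_arc _ hl).1 hx
    have h1 : E (w + ((s + r : ℝ) : ℂ)) ∈ C.carrier :=
      hIcc _ ⟨by linarith [hr.1], by linarith [hr.2]⟩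
    rwa [Complex.ofReal_add, ← add_assoc] at h1

/-! ### The closure of the set of horizontal arcs -/

/-- Arcs of bounded length form a compact set. -/
lemma isCompact_arcs [CompactSpace S] (hE : IsFlatCover E) (L : ℝ) :
    IsCompact {A | ∃ w : ℂ, ∃ l ∈ Icc 0 L, A = arc hE.continuous w l} := by
  obtain ⟨R, hR, hper⟩ := hE.exists_period_near
  have h1 : IsCompact ((fun p : ℂ × ℝ => arc hE.continuous p.1 p.2) ''
      (Metric.closedBall (0 : ℂ) R ×ˢ Icc 0 L)) :=
    ((isCompact_closedBall _ _).prod isCompact_Icc).image hE.continuous_arc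
  convert h1 using 1
  ext A
  constructor
  · rintro ⟨w, l, hl, rfl⟩
    obtain ⟨c, hc, hwc⟩ := hper w
    refine ⟨(w - c, l), ⟨mem_closedBall_zero_iff.2 hwc, hl⟩, ?_⟩
    change arc hE.continuous (w - c) l = _
    rw [← arc_add_period hE.continuous hc, sub_add_cancel]
  · rintro ⟨⟨w, l⟩, ⟨-, hl⟩, rfl⟩
    exact ⟨w, l, hl, rfl⟩

lemma whole_mem_closure [CompactSpace S] [ConnectedSpace S] (hE : IsFlatCover E)
    (hk : IsExpandingLift E k g a b) :
    Continuum.whole S ∈ closure (horizontalContinua E) := by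
  rw [Metric.mem_closure_iff]
  intro ε hε
  obtain ⟨L, -, h⟩ := hE.exists_length_dist_whole_le hk (half_pos hε)
  refine ⟨_, arc_mem_horizontalContinua hE.continuous 0 L, ?_⟩
  rw [dist_comm]
  exact (h 0 L le_rfl).trans_lt (half_lt_self hε)

lemma closure_horizontalContinua [CompactSpace S] [ConnectedSpace S] (hE : IsFlatCover E)
    (hk : IsExpandingLift E k g a b) :
    closure (horizontalContinua E) = horizontalContinua E ∪ {Continuum.whole S} := by
  apply Subset.antisymm
  · intro C hC
    by_cases hCS : C = Continuum.whole S
    · exact Or.inr hCS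
    left
    obtain ⟨x, hx⟩ : ∃ x, x ∉ C.carrier := by
      by_contra! h
      exact hCS (Continuum.ext_carrier (eq_univ_of_forall h))
    obtain ⟨ε, hε, hball⟩ := Metric.isOpen_iff.1 C.isClosed_carrier.isOpen_compl x hx
    obtain ⟨L, hL, hlong⟩ := hE.exists_length_arc_near hk (half_pos hε)
    have hmem : C ∈ closure {A | ∃ w : ℂ, ∃ l ∈ Icc 0 L, A = arc hE.continuous w l} := by
      rw [Metric.mem_closure_iff] at hC ⊢
      intro η hη
      obtain ⟨A, hA, hd⟩ := hC (min η (ε / 2)) (lt_min hη (half_pos hε))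
      obtain ⟨w, l, hl, rfl⟩ := hE.exists_eq_arc hk hA
      refine ⟨_, ⟨w, l, ⟨hl, ?_⟩, rfl⟩, hd.trans_le (min_le_left _ _)⟩
      by_contra! hlL
      obtain ⟨y, hy, hxy⟩ := hlong w l hlL.le x
      rw [dist_comm] at hd
      obtain ⟨z, hz, hyz⟩ :=
        Continuum.exists_dist_lt_of_dist_lt (hd.trans_le (min_le_right _ _)) hy
      refine hball ?_ hz
      rw [Metric.mem_ball, dist_comm]
      linarith [dist_triangle x y z]
    rw [(hE.isCompact_arcs L).isClosed.closure_eq] at hmem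
    obtain ⟨w, l, -, rfl⟩ := hmem
    exact arc_mem_horizontalContinua hE.continuous w l
  · rintro C (hC | rfl)
    · exact subset_closure hC
    · exact hE.whole_mem_closure hk

lemma isCompact_closure_horizontalContinua [CompactSpace S] [ConnectedSpace S] (hE : IsFlatCover E)
    (hk : IsExpandingLift E k g a b) : IsCompact (closure (horizontalContinua E)) := by
  rw [isCompact_iff_ultrafilter_le_nhds]
  intro f hf
  by_cases h : ∃ L : ℝ, {A | ∃ w : ℂ, ∃ l ∈ Icc 0 L, A = arc hE.continuous w l} ∈ f
  · obtain ⟨L, hL⟩ := h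
    obtain ⟨A, ⟨w, l, -, rfl⟩, hA⟩ :=
      isCompact_iff_ultrafilter_le_nhds.1 (hE.isCompact_arcs L) f (le_principal_iff.2 hL)
    exact ⟨_, subset_closure (arc_mem_horizontalContinua hE.continuous w l), hA⟩
  · push Not at h
    refine ⟨Continuum.whole S, hE.whole_mem_closure hk, ?_⟩
    rw [Metric.nhds_basis_ball.ge_iff]
    intro ε hε
    obtain ⟨L, -, hlong⟩ := hE.exists_length_dist_whole_le hk (half_pos hε)
    have h1 := Ultrafilter.compl_mem_iff_notMem.2 (h L)
    rw [le_principal_iff, hE.closure_horizontalContinua hk] at hf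
    filter_upwards [h1, hf] with A hA hA'
    rcases hA' with hA' | rfl
    · obtain ⟨w, l, hl, rfl⟩ := hE.exists_eq_arc hk hA'
      refine (hlong w l ?_).trans_lt (half_lt_self hε)
      by_contra! hlL
      exact hA ⟨w, l, ⟨hl, hlL.le⟩, rfl⟩
    · exact Metric.mem_ball_self hε

lemma isConnected_closure_horizontalContinua [CompactSpace S] (hE : IsFlatCover E)
    (hk : IsExpandingLift E k g a b) : IsConnected (closure (horizontalContinua E)) := by
  apply IsConnected.closure
  have h1 : IsConnected ((fun p : ℂ × ℝ => arc hE.continuous p.1 p.2) '' (univ ×ˢ Ici 0)) :=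
    (isConnected_univ.prod isConnected_Ici).image _ hE.continuous_arc.continuousOn
  convert h1 using 1
  ext A
  constructor
  · intro hA
    obtain ⟨w, l, hl, rfl⟩ := hE.exists_eq_arc hk hA
    exact ⟨(w, l), ⟨mem_univ w, hl⟩, rfl⟩
  · rintro ⟨⟨w, l⟩, -, rfl⟩
    exact arc_mem_horizontalContinua hE.continuous w l

/-- Every limit of horizontal continua is approximated by subcontinua of any long enough arc. -/
lemma exists_length_subcontinuum_near [CompactSpace S] [ConnectedSpace S] (hE : IsFlatCover E)
    (hk : IsExpandingLift E k g a b)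
    {ε : ℝ} (hε : 0 < ε) :
    ∃ M, ∀ w : ℂ, ∀ l ≥ M, ∀ D ∈ closure (horizontalContinua E),
      ∃ B ∈ (arc hE.continuous w l).subcontinua, dist D B ≤ ε := by
  obtain ⟨L₁, hL₁, hlong⟩ := hE.exists_length_dist_whole_le hk (half_pos hε)
  obtain ⟨δ, hδ, huc⟩ := Metric.uniformContinuous_iff.1 hE.uniformContinuous ε hε
  obtain ⟨L₂, hL₂, hnear⟩ := hE.exists_length_near hk hδ
  refine ⟨L₁ + L₂, fun w l hl D hD => ?_⟩
  have hA : dist (arc hE.continuous w l) (Continuum.whole S) ≤ ε / 2 := hlong w l (by linarith)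
  rw [hE.closure_horizontalContinua hk] at hD
  rcases hD with hD | rfl
  · obtain ⟨w', l', hl', rfl⟩ := hE.exists_eq_arc hk hD
    rcases le_total L₁ l' with h | h
    · refine ⟨_, Subset.rfl, ?_⟩
      have h1 := hlong w' l' h
      linarith [dist_triangle_right (arc hE.continuous w' l') (arc hE.continuous w l)
        (Continuum.whole S)]
    · obtain ⟨c, hc, t, ht, hd⟩ := hnear w w'
      refine ⟨arc hE.continuous (w + (t : ℝ)) l',
        arc_subset_arc hE.continuous ht.1 hl' (by linarith [ht.2]), ?_⟩
      rw [← arc_add_period hE.continuous hc]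
      refine dist_arc_le hE.continuous hε.le (fun u v => @huc u v) ?_
      rwa [dist_self, add_zero]
  · refine ⟨_, Subset.rfl, ?_⟩
    rw [dist_comm]
    linarith

lemma tendsto_distTilde [CompactSpace S] [ConnectedSpace S] (hE : IsFlatCover E)
    (hk : IsExpandingLift E k g a b)
    {A : Continuum S} (hA : A ∈ horizontalContinua E) (hA' : A.carrier.Nontrivial) :
    Tendsto (fun n : ℕ => (A.image (k ^ n)).distTilde (closure (horizontalContinua E)))
      atTop (𝓝 0) := by
  obtain ⟨w, l, hl, rfl⟩ := hE.exists_eq_arc hk hA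
  have hl0 : 0 < l := by
    refine lt_of_le_of_ne hl fun h => ?_
    subst h
    obtain ⟨x, hx, y, hy, hxy⟩ := hA'
    obtain ⟨r, hr, rfl⟩ := (mem_arc _ le_rfl).1 hx
    obtain ⟨r', hr', rfl⟩ := (mem_arc _ le_rfl).1 hy
    apply hxy
    rw [le_antisymm hr.2 hr.1, le_antisymm hr'.2 hr'.1]
  rw [Metric.tendsto_atTop]
  intro ε hε
  obtain ⟨M, hM⟩ := hE.exists_length_subcontinuum_near hk (half_pos hε)
  obtain ⟨N, hN⟩ := pow_unbounded_of_one_lt (M / l) hk.one_lt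
  refine ⟨N, fun n hn => ?_⟩
  obtain ⟨w', hw'⟩ := exists_image_pow_arc hE.continuous hk w l n
  obtain ⟨w'', hw''⟩ := exists_arc_abs hE.continuous w' (a ^ n * l)
  rw [hw', hw'']
  have hlen : M ≤ |a ^ n * l| := by
    rw [abs_mul, abs_pow, abs_of_pos hl0]
    rw [div_lt_iff₀ hl0] at hN
    have h1 : |a| ^ N ≤ |a| ^ n := pow_le_pow_right₀ hk.one_lt.le hn
    nlinarith
  rw [Real.dist_0_eq_abs, Continuum.distTilde, abs_of_nonneg Metric.hausdorffDist_nonneg]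
  refine (Metric.hausdorffDist_le_of_mem_dist (half_pos hε).le ?_ ?_).trans_lt (half_lt_self hε)
  · intro B hB
    refine ⟨B, subset_closure ?_, by rw [dist_self]; exact (half_pos hε).le⟩
    obtain ⟨u, hu⟩ := arc_mem_horizontalContinua hE.continuous w'' |a ^ n * l|
    exact ⟨u, Subset.trans hB hu⟩
  · exact fun D hD => hM w'' _ hlen D hD

end Metric

end IsFlatCover

/-- The unit vector tangent to a foliation in the regular coordinates. -/
def FoliationKind.dir : FoliationKind → ℂ
  | .stable => 1
  | .unstable => Complex.I

namespace FoliationPair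

variable {S : Type*}

/-! ### The developing map is a flat cover -/

/-- A global developing map of a compact connected flat orbifold is a covering by the plane. -/
lemma isFlatCover_of_isDevelopingAt [TopologicalSpace S] [T2Space S] [CompactSpace S]
    [ConnectedSpace S] {F : FoliationPair S} (hF : F.ProngsLeTwo) {E : ℂ → S}
    (hE : ∀ w, F.IsDevelopingAt E w) : IsFlatCover E := by
  have hopen : ∀ {E : ℂ → S}, (∀ w, F.IsDevelopingAt E w) → IsOpenMap E := by
    intro E hE
    rw [isOpenMap_iff_nhds_le]
    intro w s hs
    filter_upwards [(hE w).eventually_exists_eq hF hs] with y hy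
    obtain ⟨z, hz, rfl⟩ := hy
    exact hz
  refine ⟨continuous_iff_continuousAt.2 fun w => (hE w).continuousAt hF, hopen hE, ?_, ?_,
    fun w => (hE w).eventually_ne hF⟩
  · have hcl : IsClopen (range E) := by
      refine ⟨⟨isOpen_iff_mem_nhds.2 fun x hx => ?_⟩, (hopen hE).isOpen_range⟩
      obtain ⟨E', hE'x, hE'⟩ := exists_global_developing hF x
      filter_upwards [(hopen hE').isOpen_range.mem_nhds ⟨0, hE'x⟩]
      rintro _ ⟨z, rfl⟩ ⟨w, hw⟩
      obtain ⟨ε, c, -, -, h⟩ := eq_comp_affine_of_isDevelopingAt hF hE' hE hw.symm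
      exact hx ⟨_, (h 0).symm.trans hE'x⟩
    exact range_eq_univ.1 (hcl.eq_univ (range_nonempty E))
  · intro w w' h
    obtain ⟨ε, c, hε, hw, h⟩ := eq_comp_affine_of_isDevelopingAt hF hE hE h
    exact ⟨ε, c, hε, hw, fun u => (h u).symm⟩

/-- Both foliations become horizontal after rotating the plane. -/
lemma _root_.IsFlatCover.rotate [TopologicalSpace S] {E : ℂ → S} (hE : IsFlatCover E)
    (σ : FoliationKind) : IsFlatCover fun z => E (σ.dir * z) := by
  have hd : σ.dir ≠ 0 := by cases σ <;> simp [FoliationKind.dir]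
  refine ⟨hE.continuous.comp (continuous_const.mul continuous_id),
    hE.isOpenMap.comp (Homeomorph.mulLeft₀ σ.dir hd).isOpenMap,
    hE.surjective.comp (Homeomorph.mulLeft₀ σ.dir hd).surjective, ?_, ?_⟩
  · intro w w' h
    obtain ⟨ε, c, hε, hw, hc⟩ := hE.deck _ _ h
    refine ⟨ε, σ.dir⁻¹ * c, hε, ?_, fun u => ?_⟩
    · apply mul_left_cancel₀ hd
      rw [hw]
      field_simp
    · rw [← hc (σ.dir * u)]
      congr 1
      field_simp
  · intro w
    have h1 : Tendsto (fun z => σ.dir * z) (𝓝[≠] w) (𝓝[≠] (σ.dir * w)) := by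
      apply tendsto_nhdsWithin_of_tendsto_nhds_of_eventually_within
      · exact ((continuous_const.mul continuous_id).tendsto w).mono_left nhdsWithin_le_nhds
      · filter_upwards [eventually_mem_nhdsWithin] with z hz h
        exact hz (mul_left_cancel₀ hd h)
    exact h1.eventually (hE.isolated _)

/-! ### Leaves are images of lines -/

lemma _root_.FoliationKind.dir_mul_sq_mem_halfLine (σ : FoliationKind) (t : ℝ) :
    (σ.dir * t) ^ 2 ∈ σ.halfLine := by
  have h : ((t : ℂ)) ^ 2 = ((t ^ 2 : ℝ) : ℂ) := by push_cast; rfl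
  cases σ
  · simp only [FoliationKind.dir, FoliationKind.halfLine, one_mul, h]
    exact ⟨Complex.ofReal_im _, by rw [Complex.ofReal_re]; positivity⟩
  · simp only [FoliationKind.dir, FoliationKind.halfLine, mul_pow, Complex.I_sq, h, neg_one_mul]
    refine ⟨?_, ?_⟩
    · rw [Complex.neg_im, Complex.ofReal_im, neg_zero]
    · rw [Complex.neg_re, Complex.ofReal_re]
      nlinarith

lemma _root_.FoliationKind.exists_eq_dir_mul (σ : FoliationKind) {h : ℂ}
    (hh : h ^ 2 ∈ σ.halfLine) : ∃ t : ℝ, h = σ.dir * t := by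
  have him : (h ^ 2).im = 2 * (h.re * h.im) := by
    rw [sq, Complex.mul_im]
    ring
  have hre : (h ^ 2).re = h.re ^ 2 - h.im ^ 2 := by
    rw [sq, Complex.mul_re]
    ring
  cases σ
  · obtain ⟨h1, h2⟩ := hh
    rw [him] at h1
    rw [hre] at h2
    have h3 : h.im = 0 := by
      rcases mul_eq_zero.1 (mul_eq_zero.1 h1 |>.resolve_left two_ne_zero) with h | h
      · rw [h] at h2
        nlinarith
      · exact h
    exact ⟨h.re, Complex.ext (by simp [FoliationKind.dir]) (by simp [FoliationKind.dir, h3])⟩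
  · obtain ⟨h1, h2⟩ := hh
    rw [him] at h1
    rw [hre] at h2
    have h3 : h.re = 0 := by
      rcases mul_eq_zero.1 (mul_eq_zero.1 h1 |>.resolve_left two_ne_zero) with h | h
      · exact h
      · rw [h] at h2
        nlinarith
    exact ⟨h.im, Complex.ext (by simp [FoliationKind.dir, h3]) (by simp [FoliationKind.dir])⟩

/-- Near `w`, a developing map `E` turns the star of the foliation at `E w` into a line. -/
lemma IsDevelopingAt.eventually_chart_pow [TopologicalSpace S] {F : FoliationPair S}
    (hF : F.ProngsLeTwo) {E : ℂ → S} {w : ℂ} (h : F.IsDevelopingAt E w) :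
    ∀ᶠ z in 𝓝 w, F.chart (E w) (E z) ^ F.prongs (E w) = (z - w) ^ 2 := by
  obtain ⟨ε, hε, h⟩ := h
  filter_upwards [h, (tendsto_sign_mul_sub ε w).eventually
    (eventually_zero_pow_mem_target hF (E w))] with z h1 h2
  rw [h1, chart_orbifoldChart_pow hF _ h2]
  rcases hε with rfl | rfl <;> ring

/-- The image of a line is invariant under moving along lifts of it in the same direction. -/
lemma _root_.IsFlatCover.add_mem_range [TopologicalSpace S] {E : ℂ → S} (hE : IsFlatCover E)
    (σ : FoliationKind) {u w : ℂ} (r : ℝ) (h : E u ∈ range fun t : ℝ => E (σ.dir * (w + t))) :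
    E (u + σ.dir * r) ∈ range fun t : ℝ => E (σ.dir * (w + t)) := by
  obtain ⟨t, ht⟩ := h
  obtain ⟨ε, c, hε, rfl, hc⟩ := hE.deck _ _ ht
  rcases hε with rfl | rfl
  · refine ⟨t + r, ?_⟩
    dsimp only
    rw [← hc]
    congr 1
    push_cast
    ring
  · refine ⟨t - r, ?_⟩
    dsimp only
    rw [← hc]
    congr 1
    push_cast
    ring

lemma leaf_eq_range [TopologicalSpace S] [T2Space S] [CompactSpace S]
    [ConnectedSpace S] {F : FoliationPair S} (hF : F.ProngsLeTwo) {E : ℂ → S}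
    (hE : ∀ w, F.IsDevelopingAt E w) (σ : FoliationKind) (w : ℂ) :
    F.leaf σ (E (σ.dir * w)) = range fun t : ℝ => E (σ.dir * (w + t)) := by
  have hcov := isFlatCover_of_isDevelopingAt hF hE
  apply Subset.antisymm
  · rintro y ⟨γ, hγ⟩
    set B : Set unitInterval := {t | γ t ∈ range fun t : ℝ => E (σ.dir * (w + t))} with hB
    have key : ∀ t, ∀ᶠ s in 𝓝 t, (s ∈ B ↔ t ∈ B) := by
      intro t
      obtain ⟨u, hu⟩ := hcov.surjective (γ t)
      have h1 := (hE u).eventually_exists_eq hF ((hE u).eventually_chart_pow hF)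
      rw [hu] at h1
      filter_upwards [hγ t, (γ.continuous.tendsto t).eventually h1] with s hs hs'
      obtain ⟨z, hz, hzs⟩ := hs'
      replace hz : F.chart (γ t) (E z) ^ F.prongs (γ t) = (z - u) ^ 2 := hz
      rw [hzs] at hz
      rw [hz] at hs
      obtain ⟨r, hr⟩ := σ.exists_eq_dir_mul hs
      obtain rfl : z = u + σ.dir * r := by rw [← hr]; ring
      rw [hB, mem_ofPred_eq, mem_ofPred_eq, ← hzs, ← hu]
      refine ⟨fun h => ?_, fun h => hcov.add_mem_range σ r h⟩
      have h2 := hcov.add_mem_range σ (-r) h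
      rwa [Complex.ofReal_neg, mul_neg, add_neg_cancel_right] at h2
    have hclopen : IsClopen B := by
      refine ⟨⟨isOpen_iff_mem_nhds.2 fun t ht => ?_⟩, isOpen_iff_mem_nhds.2 fun t ht => ?_⟩
      · filter_upwards [key t] with s hs h
        exact ht (hs.1 h)
      · filter_upwards [key t] with s hs
        exact hs.2 ht
    have h0 : (0 : unitInterval) ∈ B := ⟨0, by simp⟩
    have h1 : (1 : unitInterval) ∈ B := by
      rw [hclopen.eq_univ ⟨0, h0⟩]
      exact mem_univ _
    rw [← γ.target]
    exact h1
  · rintro _ ⟨r, rfl⟩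
    have hcont : Continuous fun t : unitInterval => σ.dir * (w + ((t : ℝ) * r : ℝ)) := by fun_prop
    refine ⟨⟨⟨fun t => E (σ.dir * (w + ((t : ℝ) * r : ℝ))), hcov.continuous.comp hcont⟩,
      by simp, by simp⟩, fun t => ?_⟩
    filter_upwards [(hcont.tendsto t).eventually ((hE _).eventually_chart_pow hF)] with s hs
    change F.chart (E (σ.dir * (w + ((t : ℝ) * r : ℝ)))) (E (σ.dir * (w + ((s : ℝ) * r : ℝ)))) ^
      F.prongs (E (σ.dir * (w + ((t : ℝ) * r : ℝ)))) ∈ _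
    rw [hs]
    convert σ.dir_mul_sq_mem_halfLine (((s : ℝ) - t) * r) using 2
    push_cast
    ring

lemma leafContinua_eq [TopologicalSpace S] [T2Space S] [CompactSpace S]
    [ConnectedSpace S] {F : FoliationPair S} (hF : F.ProngsLeTwo) {E : ℂ → S}
    (hE : ∀ w, F.IsDevelopingAt E w) (σ : FoliationKind) :
    F.leafContinua σ = horizontalContinua fun z => E (σ.dir * z) := by
  ext A
  constructor
  · rintro ⟨x, hx⟩
    obtain ⟨w, rfl⟩ := ((isFlatCover_of_isDevelopingAt hF hE).rotate σ).surjective x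
    rw [leaf_eq_range hF hE] at hx
    exact ⟨w, hx⟩
  · rintro ⟨w, hw⟩
    refine ⟨E (σ.dir * w), ?_⟩
    rw [leaf_eq_range hF hE]
    exact hw

/-! ### Lifting a pseudo-Anosov map to the plane -/

lemma dense_re_ne_im_ne (w : ℂ) : Dense {z : ℂ | z.re ≠ w.re ∧ z.im ≠ w.im} := by
  have h : {z : ℂ | z.re ≠ w.re ∧ z.im ≠ w.im} = {w.re}ᶜ ×ℂ {w.im}ᶜ := by
    ext z
    rw [Complex.mem_reProdIm]
    rfl
  rw [h, dense_iff_closure_eq, Complex.closure_reProdIm,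
    (dense_compl_singleton w.re).closure_eq, (dense_compl_singleton w.im).closure_eq]
  ext z
  simp [Complex.mem_reProdIm]

/-- Near a lift of a regular point, a pseudo-Anosov map is linear in natural coordinates. -/
lemma eventually_map_eq_orbifoldChart [TopologicalSpace S] {F : FoliationPair S}
    (hF : F.ProngsLeTwo) {E : ℂ → S} {f : S ≃ₜ S} {lam : ℝ} (hlam : 0 < lam)
    (hprongs : ∀ p, F.prongs (f p) = F.prongs p)
    (hlocal : ∀ p, F.prongs p = 2 →
      ∃ ε δ : ℝ, (ε = 1 ∨ ε = -1) ∧ (δ = 1 ∨ δ = -1) ∧ ∀ᶠ x in 𝓝 p,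
        (F.chart (f p) (f x)).re = ε * lam⁻¹ * (F.chart p x).re ∧
        (F.chart (f p) (f x)).im = δ * lam * (F.chart p x).im)
    {w : ℂ} (hw : F.IsDevelopingAt E w) (hreg : F.prongs (E w) = 2) :
    ∃ a b : ℝ, |a| = lam⁻¹ ∧ |b| = lam ∧ ∀ᶠ z in 𝓝 w,
      f (E z) = F.orbifoldChart (f (E w)) ⟨a * (z - w).re, b * (z - w).im⟩ := by
  have hcont := hw.continuousAt hF
  obtain ⟨ε, hε, h⟩ := hw
  obtain ⟨α, β, hα, hβ, hloc⟩ := hlocal _ hreg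
  obtain ⟨e, he, rfl⟩ : ∃ e : ℝ, (e = 1 ∨ e = -1) ∧ ε = e := by
    rcases hε with rfl | rfl
    · exact ⟨1, Or.inl rfl, by simp⟩
    · exact ⟨-1, Or.inr rfl, by simp⟩
  refine ⟨α * lam⁻¹ * e, β * lam * e, ?_, ?_, ?_⟩
  · rcases he with rfl | rfl <;> rcases hα with rfl | rfl <;> simp [abs_of_pos hlam]
  · rcases he with rfl | rfl <;> rcases hβ with rfl | rfl <;> simp [abs_of_pos hlam]
  have hsrc : ∀ᶠ z in 𝓝 w, f (E z) ∈ (F.chart (f (E w))).source :=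
    (f.continuous.continuousAt.comp hcont).eventually
      ((F.chart _).open_source.mem_nhds (F.mem_source _))
  filter_upwards [h, hcont.eventually hloc, hsrc, (tendsto_sign_mul_sub (e : ℂ) w).eventually
    (eventually_zero_pow_mem_target hF (E w))] with z h1 h2 h3 h4
  have h5 : F.chart (E w) (E z) = e * (z - w) := by
    rw [h1, F.chart_orbifoldChart _ h4, hreg, Nat.div_self two_pos, pow_one]
  rw [h5, Complex.re_ofReal_mul, Complex.im_ofReal_mul] at h2
  have h6 : F.chart (f (E w)) (f (E z)) =
      ⟨α * lam⁻¹ * e * (z - w).re, β * lam * e * (z - w).im⟩ :=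
    Complex.ext (by rw [h2.1]; ring) (by rw [h2.2]; ring)
  rw [orbifoldChart, hprongs, hreg, Nat.div_self two_pos, pow_one, ← h6, (F.chart _).left_inv h3]

lemma continuous_diag (a b : ℝ) : Continuous fun h : ℂ => (⟨a * h.re, b * h.im⟩ : ℂ) :=
  Complex.equivRealProdCLM.symm.continuous.comp
    ((continuous_const.mul Complex.continuous_re).prodMk
      (continuous_const.mul Complex.continuous_im))

/-- A pseudo-Anosov map lifts to an affine map of the plane: its local linear expressions continue
along the complement of the lifts of the 1-prongs, which is
connected because these are countably many. -/
lemma IsPseudoAnosov.exists_lift [TopologicalSpace S] [T2Space S] [CompactSpace S]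
    [ConnectedSpace S] {F : FoliationPair S} (hF : F.ProngsLeTwo) {E : ℂ → S}
    (hE : ∀ w, F.IsDevelopingAt E w) {f : S ≃ₜ S} (hf : F.IsPseudoAnosov f) :
    ∃ (lam a b : ℝ) (c : ℂ), 1 < lam ∧ |a| = lam⁻¹ ∧ |b| = lam ∧
      ∀ w, f (E w) = E (⟨a * w.re, b * w.im⟩ + c) := by
  obtain ⟨lam, hlam, hprongs, hlocal⟩ := hf
  have hcov := isFlatCover_of_isDevelopingAt hF hE
  have hloc : ∀ w, F.prongs (E w) = 2 → ∃ a b : ℝ, |a| = lam⁻¹ ∧ |b| = lam ∧ ∀ᶠ z in 𝓝 w,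
      f (E z) = F.orbifoldChart (f (E w)) ⟨a * (z - w).re, b * (z - w).im⟩ :=
    fun w hw => eventually_map_eq_orbifoldChart hF (by linarith) hprongs hlocal (hE w) hw
  set W : Set ℂ := {w | F.prongs (E w) = 2} with hW
  have hWc : Wᶜ.Countable := by
    have : Wᶜ = ⋃ p ∈ {p | F.prongs p ≠ 2}, E ⁻¹' {p} := by
      ext w
      simp [hW]
    rw [this]
    exact F.finite_singularities.countable.biUnion fun p _ => hcov.countable_fiber p
  have hWpre : IsPreconnected W := by
    have h1 := hWc.isPathConnected_compl_of_one_lt_rank (by simp [Complex.rank_real_complex])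
    rw [compl_compl] at h1
    exact h1.isConnected.isPreconnected
  have hWd : Dense W := by
    have h1 := hWc.dense_compl ℝ
    rwa [compl_compl] at h1
  obtain ⟨w₀, hw₀⟩ := hWd.nonempty
  obtain ⟨a, b, ha, hb, h₀⟩ := hloc w₀ hw₀
  have ha0 : a ≠ 0 := by
    rintro rfl
    rw [abs_zero] at ha
    have : 0 < lam⁻¹ := by positivity
    linarith
  have hb0 : b ≠ 0 := by
    rintro rfl
    rw [abs_zero] at hb
    linarith
  -- the developing map that is to agree with `f ∘ E`, up to a linear change of variable
  obtain ⟨G, hG₀, hG⟩ :=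
    (eventually_isDevelopingAt_orbifoldChart hF (f (E w₀))).self_of_nhds.exists_global hF
  set A : ℂ → ℂ := fun z => ⟨a * (z - w₀).re, b * (z - w₀).im⟩ with hA
  have hAc : Continuous A := (continuous_diag a b).comp (continuous_id.sub continuous_const)
  have hGc := (isFlatCover_of_isDevelopingAt hF hG).continuous
  have hfE : Continuous fun z => f (E z) := f.continuous.comp hcov.continuous
  set V : Set ℂ := {w | (fun z => f (E z)) =ᶠ[𝓝 w] fun z => G (A z)} with hV
  have hVeq : ∀ w ∈ V, f (E w) = G (A w) := fun w hw => Filter.EventuallyEq.eq_of_nhds hw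
  have hVo : IsOpen V := by
    rw [isOpen_iff_mem_nhds]
    intro w hw
    exact Filter.Eventually.eventually_nhds hw
  have hw₀V : w₀ ∈ V := by
    have hA0 : A w₀ = 0 := by
      simp only [hA, sub_self, Complex.zero_re, Complex.zero_im, mul_zero]
      rfl
    have h1 : Tendsto A (𝓝 w₀) (𝓝 0) := hA0 ▸ hAc.tendsto w₀
    change ∀ᶠ z in 𝓝 w₀, _
    filter_upwards [h₀, h1.eventually hG₀] with z h2 h3
    rw [h2, h3]
  have hWV : W ⊆ V := by
    refine hWpre.subset_of_closure_inter_subset hVo ⟨w₀, hw₀, hw₀V⟩ ?_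
    rintro w ⟨hwV, hwW⟩
    obtain ⟨a', b', -, -, h₁⟩ := hloc w hwW
    -- a nearby point of agreement with both coordinates different from those of `w`
    have hwD : w ∈ closure (V ∩ {z : ℂ | z.re ≠ w.re ∧ z.im ≠ w.im}) :=
      closure_minimal ((dense_re_ne_im_ne w).open_subset_closure_inter hVo) isClosed_closure hwV
    rw [mem_closure_iff_frequently] at hwD
    have hval : f (E w) = G (A w) :=
      tendsto_nhds_unique_of_frequently_eq (hfE.tendsto w) ((hGc.comp hAc).tendsto w)
        (hwD.mono fun z hz => hVeq z hz.1)
    obtain ⟨ε, hε, h₂⟩ := hG (A w)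
    rw [← hval] at h₂
    replace h₂ := (hAc.tendsto w).eventually h₂
    have htgt := eventually_zero_pow_mem_target hF (f (E w))
    have ht₁ : Tendsto (fun z : ℂ => (⟨a' * (z - w).re, b' * (z - w).im⟩ : ℂ)) (𝓝 w) (𝓝 0) := by
      have := ((continuous_diag a' b').comp (continuous_id.sub continuous_const)).tendsto
        (f := fun z : ℂ => (⟨a' * (z - w).re, b' * (z - w).im⟩ : ℂ)) w
      simp only [sub_self, Complex.zero_re, Complex.zero_im, mul_zero] at this
      exact this
    have ht₂ : Tendsto (fun z : ℂ => ε * (A z - A w)) (𝓝 w) (𝓝 0) :=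
      (tendsto_sign_mul_sub ε (A w)).comp (hAc.tendsto w)
    obtain ⟨z, ⟨hzV, hzre, hzim⟩, e₁, e₂, t₁, t₂⟩ := (hwD.and_eventually
      (h₁.and (h₂.and ((ht₁.eventually htgt).and (ht₂.eventually htgt))))).exists
    have hz : f (E z) = G (A z) := hVeq z hzV
    rw [e₁, e₂] at hz
    have h3 := F.chart_orbifoldChart _ t₁
    rw [hz, F.chart_orbifoldChart _ t₂, hprongs, show F.prongs (E w) = 2 from hwW,
      Nat.div_self two_pos, pow_one, pow_one] at h3
    have hAA : ∀ z, A z - A w = ⟨a * (z - w).re, b * (z - w).im⟩ := by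
      intro z
      apply Complex.ext
      · simp only [hA, Complex.sub_re]
        ring
      · simp only [hA, Complex.sub_im]
        ring
    have hzre' : (z - w).re ≠ 0 := by
      rw [Complex.sub_re]
      exact sub_ne_zero.2 hzre
    have hzim' : (z - w).im ≠ 0 := by
      rw [Complex.sub_im]
      exact sub_ne_zero.2 hzim
    obtain ⟨e, rfl⟩ : ∃ e : ℝ, ε = e := by
      rcases hε with rfl | rfl
      · exact ⟨1, by simp⟩
      · exact ⟨-1, by simp⟩
    rw [hAA] at h3
    have hre := congrArg Complex.re h3
    have him := congrArg Complex.im h3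
    rw [Complex.re_ofReal_mul] at hre
    rw [Complex.im_ofReal_mul] at him
    have haa : e * a = a' := by
      apply mul_right_cancel₀ hzre'
      rw [mul_assoc]
      exact hre
    have hbb : e * b = b' := by
      apply mul_right_cancel₀ hzim'
      rw [mul_assoc]
      exact him
    change ∀ᶠ y in 𝓝 w, _
    filter_upwards [h₁, h₂] with y y₁ y₂
    rw [y₁, y₂, hAA]
    congr 1
    apply Complex.ext
    · rw [Complex.re_ofReal_mul, ← haa, mul_assoc]
    · rw [Complex.im_ofReal_mul, ← hbb, mul_assoc]
  have hfG : ∀ w, f (E w) = G (A w) := fun w =>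
    congrFun (hfE.ext_on hWd (hGc.comp hAc)
      fun w hw => hVeq w (hWV hw)) w
  obtain ⟨w₁, hw₁⟩ := hcov.surjective (G 0)
  obtain ⟨ε, c, hε, -, hc⟩ := eq_comp_affine_of_isDevelopingAt hF hG hE hw₁.symm
  obtain ⟨e, he, rfl⟩ : ∃ e : ℝ, |e| = 1 ∧ ε = e := by
    rcases hε with rfl | rfl
    · exact ⟨1, by simp⟩
    · exact ⟨-1, by simp⟩
  refine ⟨lam, e * a, e * b, c - ⟨e * a * w₀.re, e * b * w₀.im⟩, hlam, ?_, ?_, fun w => ?_⟩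
  · rw [abs_mul, he, one_mul, ha]
  · rw [abs_mul, he, one_mul, hb]
  · rw [hfG, hc]
    congr 1
    apply Complex.ext
    · simp only [hA, Complex.add_re, Complex.sub_re, Complex.re_ofReal_mul]
      ring
    · simp only [hA, Complex.add_im, Complex.sub_im, Complex.im_ofReal_mul]
      ring

/-- The inverse of a pseudo-Anosov map expands the stable direction. -/
lemma isExpandingLift_stable [TopologicalSpace S] {E : ℂ → S} {f : S ≃ₜ S} {lam a b : ℝ} {c : ℂ}
    (hlam : 1 < lam) (ha : |a| = lam⁻¹) (hb : |b| = lam)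
    (h : ∀ w, f (E w) = E (⟨a * w.re, b * w.im⟩ + c)) :
    IsExpandingLift (fun z => E (FoliationKind.stable.dir * z)) f⁻¹
      (fun w => ⟨a⁻¹ * (w - c).re, b⁻¹ * (w - c).im⟩) a⁻¹ b⁻¹ := by
  have ha0 : a ≠ 0 := by
    rintro rfl
    rw [abs_zero] at ha
    have : 0 < lam⁻¹ := by positivity
    linarith
  have hb0 : b ≠ 0 := by
    rintro rfl
    rw [abs_zero] at hb
    linarith
  refine ⟨fun w => ?_, fun w u => ?_, ?_, ?_, inv_ne_zero hb0⟩
  · apply f.injective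
    rw [show f (f⁻¹ (E (FoliationKind.stable.dir * w))) = E (FoliationKind.stable.dir * w) from
      f.apply_symm_apply _]
    simp only [FoliationKind.dir, one_mul]
    rw [h, mul_inv_cancel_left₀ ha0, mul_inv_cancel_left₀ hb0]
    congr 1
    rw [Complex.eta, sub_add_cancel]
  · apply Complex.ext
    · simp only [Complex.add_re, Complex.sub_re]
      ring
    · simp only [Complex.add_im, Complex.sub_im]
      ring
  · rw [abs_inv, ha, inv_inv]
    exact hlam
  · rw [abs_inv, hb]
    exact inv_lt_one_of_one_lt₀ hlam

/-- A pseudo-Anosov map expands the unstable direction. -/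
lemma isExpandingLift_unstable [TopologicalSpace S] {E : ℂ → S} {f : S ≃ₜ S} {lam a b : ℝ} {c : ℂ}
    (hlam : 1 < lam) (ha : |a| = lam⁻¹) (hb : |b| = lam)
    (h : ∀ w, f (E w) = E (⟨a * w.re, b * w.im⟩ + c)) :
    IsExpandingLift (fun z => E (FoliationKind.unstable.dir * z)) f
      (fun w => ⟨b * w.re, a * w.im⟩ - Complex.I * c) b a := by
  refine ⟨fun w => ?_, fun w u => ?_, by rwa [hb], ?_, ?_⟩
  · simp only [FoliationKind.dir]
    rw [h]
    congr 1
    apply Complex.ext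
    · simp
      ring
    · simp
  · apply Complex.ext
    · simp only [Complex.add_re, Complex.sub_re]
      ring
    · simp only [Complex.add_im, Complex.sub_im]
      ring
  · rw [ha]
    exact inv_lt_one_of_one_lt₀ hlam
  · rintro rfl
    rw [abs_zero] at ha
    have : 0 < lam⁻¹ := by positivity
    linarith

end FoliationPair

end

theorem theorem3p4 {S : Type*} [MetricSpace S] [CompactSpace S] [ConnectedSpace S]
    (F : FoliationPair S) (f : S ≃ₜ S) (hf : F.IsPseudoAnosov f)
    (hcurv : ∀ p, 0 ≤ F.curvature p) :
    (∀ σ : FoliationKind,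
      IsCompact (F.hyper σ) ∧ IsConnected (F.hyper σ) ∧
      F.hyper σ = F.leafContinua σ ∪ {Continuum.whole S}) ∧
    (∀ A ∈ F.leafContinua .stable, A.carrier.Nontrivial →
      Tendsto (fun n : ℕ => (A.image (f ^ (-(n : ℤ)))).distTilde (F.hyper .stable))
        atTop (𝓝 0)) ∧
    (∀ A ∈ F.leafContinua .unstable, A.carrier.Nontrivial →
      Tendsto (fun n : ℕ => (A.image (f ^ (n : ℤ))).distTilde (F.hyper .unstable))
        atTop (𝓝 0)) := by
  have hF := FoliationPair.prongsLeTwo_of_curvature hcurv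
  obtain ⟨x⟩ : Nonempty S := inferInstance
  obtain ⟨E, -, hE⟩ := FoliationPair.exists_global_developing hF x
  have hcov := FoliationPair.isFlatCover_of_isDevelopingAt hF hE
  obtain ⟨lam, a, b, c, hlam, ha, hb, hlift⟩ := hf.exists_lift hF hE
  have hs := FoliationPair.isExpandingLift_stable hlam ha hb hlift
  have hu := FoliationPair.isExpandingLift_unstable hlam ha hb hlift
  have hcont := FoliationPair.leafContinua_eq hF hE
  simp only [FoliationPair.hyper, hcont]
  refine ⟨fun σ => ?_, fun A hA hA' => ?_, fun A hA hA' => ?_⟩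
  · obtain ⟨k, g, α, β, hk⟩ : ∃ k g α β,
        IsExpandingLift (fun z => E (σ.dir * z)) k g α β := by
      cases σ
      · exact ⟨_, _, _, _, hs⟩
      · exact ⟨_, _, _, _, hu⟩
    have hr := hcov.rotate σ
    exact ⟨hr.isCompact_closure_horizontalContinua hk,
      hr.isConnected_closure_horizontalContinua hk, hr.closure_horizontalContinua hk⟩
  · simp only [zpow_neg, zpow_natCast, ← inv_pow]
    exact (hcov.rotate .stable).tendsto_distTilde hs hA hA'
  · simp only [zpow_natCast]
    exact (hcov.rotate .unstable).tendsto_distTilde hu hA hA'
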